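/- Let $G$ be a simple graph with vertices $1,\dots,n$, $n\ge 4$, and let $\Gamma$ be a generic shortest-path triangulation of the unit sphere $S^2$ with underlying graph $G$. That is, $\Gamma$ is an embedding of $G$ on $S^2$ in which every edge is a great-circular arc of length less than $\pi$ and every face is bounded by a cycle of three edges; no great circle contains more than two vertices; and no great circle through the poles $(0,0,\pm1)$ contains more than one vertex. Faces are written as triples $(i,j,k)$ of their vertices in counterclockwise order around the interior of the face. The north (south) face is the face containing the north (south) pole in its interior; we assume that these two faces are different. All other faces are called non-polar. A longitude is an open great semicircle joining the two poles. Call $\Gamma$ *sinkable* if there is a continuous family of embeddings $\Gamma_t$, $t\in[0,1]$, of $G$, with all edges shortest paths, such that $\Gamma_0=\Gamma$, every vertex stays on its longitude for all $t$, and $\Gamma_1$ is a generic shortest-path triangulation all of whose vertices lie strictly below the equator ($z<0$). Let $(x_i,y_i,z_i)$ be any positive multiple of the position vector of vertex $i$, for each $i$. Then $\Gamma$ is sinkable if and only if the following linear program in the variables $z'_1,\dots,z'_n$ is feasible: $$\begin{array}{rll} \text{maximize} & \sum_i z'_i\\ \text{subject to} & z'_i=-1 & \text{for every vertex } i \text{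 of the north face},\\ & \mathrm{vol}'(i,j,k)\ge 0 & \text{for every non-polar face } (i,j,k), \end{array}$$ where $$\mathrm{vol}'(i,j,k)=\det\begin{pmatrix}x_i&y_i&z'_i\\x_j&y_j&z'_j\\x_k&y_k&z'_k\end{pmatrix}.$$ -/

import Mathlib

noncomputable section

namespace Sinking

/-- Euclidean three-space. -/
abbrev E3 : Type := EuclideanSpace ℝ (Fin 3)

/-- The unit sphere `x² + y² + z² = 1`. -/
abbrev S2 : Type := Metric.sphere (0 : E3) 1

/-- The point `(0, 0, 1)`. -/
def northPole : S2 :=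
  ⟨!₂[0, 0, 1], by simp [EuclideanSpace.norm_eq, Fin.sum_univ_three]⟩

/-- The point `(0, 0, -1)`. -/
def southPole : S2 :=
  ⟨!₂[0, 0, -1], by simp [EuclideanSpace.norm_eq, Fin.sum_univ_three]⟩

/-- The great circle with normal vector `ν` (which is required to be nonzero wherever this is
used). -/
def greatCircle (ν : E3) : Set S2 := {w | inner ℝ ν (w : E3) = 0}

/-- The longitude at angle `θ`: the open great semicircle from pole to pole through
`(cos θ, sin θ, 0)`. The poles themselves are on no longitude. -/
def longitude (θ : ℝ) : Set S2 :=
  {w | ∃ r : ℝ, 0 < r ∧ (w : E3) 0 = r * Real.cos θ ∧ (w : E3) 1 = r * Real.sin θ}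

/-- Two points lie on a common longitude. -/
def SameLongitude (u v : S2) : Prop := ∃ θ : ℝ, u ∈ longitude θ ∧ v ∈ longitude θ

/-- The shortest path on the sphere between two points that are not antipodal. -/
def arc (u v : S2) : Set S2 :=
  {w | ∃ a b : ℝ, 0 ≤ a ∧ 0 ≤ b ∧ (w : E3) = a • (u : E3) + b • (v : E3)}

/-- The determinant of the matrix with rows `u`, `v`, `w`. -/
def det3 (u v w : E3) : ℝ :=
  Matrix.det !![u 0, u 1, u 2; v 0, v 1, v 2; w 0, w 1, w 2]

/-- The open spherical triangle spanned by three linearly independent points. -/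
def openTriangle (u v w : S2) : Set S2 :=
  {s | ∃ a b c : ℝ, 0 < a ∧ 0 < b ∧ 0 < c ∧
    (s : E3) = a • (u : E3) + b • (v : E3) + c • (w : E3)}

/-- The closed spherical triangle spanned by three linearly independent points. -/
def closedTriangle (u v w : S2) : Set S2 :=
  {s | ∃ a b c : ℝ, 0 ≤ a ∧ 0 ≤ b ∧ 0 ≤ c ∧
    (s : E3) = a • (u : E3) + b • (v : E3) + c • (w : E3)}

/-- The side of the geodesic triangle `u → v → w → u` around which this cycle runs
counterclockwise (seen from outside the sphere), that is, the side to the left of the cycle. It is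
the small triangle if `(u, v, w)` is positively oriented, and the complement of the small triangle
(a region of area greater than `2π`) if `(u, v, w)` is negatively oriented. -/
def ccwRegion (u v w : S2) : Set S2 :=
  {s | (0 < det3 u v w ∧ s ∈ openTriangle u v w) ∨
    (det3 u v w < 0 ∧ s ∉ closedTriangle u v w)}

section Drawings

variable {n : ℕ}

/-- The map `p` of the vertices to the sphere, with every edge drawn as the shortest path between
its endpoints, is an embedding of `G`: vertices are distinct points, edges have length less than
`π`, and edges meet vertices and other edges only at common endpoints. -/
structure IsShortestPathEmbedding (G : SimpleGraph (Fin n)) (p : Fin n → S2) : Prop where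
  injective : Function.Injective p
  length_lt : ∀ i j, G.Adj i j → InnerProductGeometry.angle (p i : E3) (p j : E3) < Real.pi
  vertex_edge : ∀ i j k, G.Adj i j → p k ∈ arc (p i) (p j) → k = i ∨ k = j
  edge_edge : ∀ i j k l, G.Adj i j → G.Adj k l → s(i, j) ≠ s(k, l) →
    ∀ w, w ∈ arc (p i) (p j) → w ∈ arc (p k) (p l) →
      ∃ m, (m = i ∨ m = j) ∧ (m = k ∨ m = l) ∧ w = p m

/-- The set of points of the sphere covered by the vertices and edges of the drawing. -/
def drawing (G : SimpleGraph (Fin n)) (p : Fin n → S2) : Set S2 :=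
  {w | (∃ i, w = p i) ∨ ∃ i j, G.Adj i j ∧ w ∈ arc (p i) (p j)}

/-- The faces of a drawing: the connected components of the complement of the drawing. -/
def IsFaceSet (G : SimpleGraph (Fin n)) (p : Fin n → S2) (F : Set S2) : Prop :=
  ∃ x, x ∉ drawing G p ∧ F = connectedComponentIn (drawing G p)ᶜ x

/-- The three vertices `i, j, k` are mutually adjacent and bound a face, around whose interior they
appear in counterclockwise order. (For vertices on no common great circle.) -/
def IsFace (G : SimpleGraph (Fin n)) (p : Fin n → S2) (i j k : Fin n) : Prop :=
  G.Adj i j ∧ G.Adj j k ∧ G.Adj k i ∧ IsFaceSet G p (ccwRegion (p i) (p j) (p k))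

/-- `p` is a generic shortest-path triangulation with underlying graph `G`: an embedding with
shortest-path edges, with at most two vertices on any great circle and at most one vertex on any
great circle through the poles, such that every face is bounded by a cycle of three edges. -/
structure IsGenericTriangulation (G : SimpleGraph (Fin n)) (p : Fin n → S2) : Prop where
  embedding : IsShortestPathEmbedding G p
  generic : ∀ ν : E3, ν ≠ 0 → {i | p i ∈ greatCircle ν}.ncard ≤ 2
  generic_pole : ∀ ν : E3, ν ≠ 0 → northPole ∈ greatCircle ν → southPole ∈ greatCircle ν →
    {i | p i ∈ greatCircle ν}.ncard ≤ 1
  triangular : ∀ F, IsFaceSet G p F → ∃ i j k, G.Adj i j ∧ G.Adj j k ∧ G.Adj k i ∧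
    F = ccwRegion (p i) (p j) (p k)

/-- `(i, j, k)` is the north face: its interior contains the north pole. -/
def IsNorthFace (G : SimpleGraph (Fin n)) (p : Fin n → S2) (i j k : Fin n) : Prop :=
  IsFace G p i j k ∧ northPole ∈ ccwRegion (p i) (p j) (p k)

/-- `(i, j, k)` is the south face: its interior contains the south pole. -/
def IsSouthFace (G : SimpleGraph (Fin n)) (p : Fin n → S2) (i j k : Fin n) : Prop :=
  IsFace G p i j k ∧ southPole ∈ ccwRegion (p i) (p j) (p k)

/-- `(i, j, k)` is a face that is neither the north face nor the south face. -/
def IsNonPolarFace (G : SimpleGraph (Fin n)) (p : Fin n → S2) (i j k : Fin n) : Prop :=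
  IsFace G p i j k ∧ ¬ IsNorthFace G p i j k ∧ ¬ IsSouthFace G p i j k

/-- `H` is a longitudinal morph from `p` to `q`: a continuous family of shortest-path embeddings
in which every vertex stays on its longitude. (The shortest-path edges are determined by their
endpoints and vary continuously with them.) -/
structure IsLongitudinalMorph (G : SimpleGraph (Fin n)) (p q : Fin n → S2)
    (H : unitInterval → Fin n → S2) : Prop where
  continuous : ∀ i, Continuous fun t => H t i
  source : H 0 = p
  target : H 1 = q
  embedding : ∀ t, IsShortestPathEmbedding G (H t)
  longitudinal : ∀ t i, SameLongitude (p i) (H t i)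

/-- A triangulation is southern if every vertex lies below the equator. -/
def IsSouthern (p : Fin n → S2) : Prop := ∀ i, (p i : E3) 2 < 0

/-- A triangulation is sinkable if there is a longitudinal morph from it to a southern
triangulation. -/
def Sinkable (G : SimpleGraph (Fin n)) (p : Fin n → S2) : Prop :=
  ∃ q : Fin n → S2, IsGenericTriangulation G q ∧ IsSouthern q ∧
    ∃ H : unitInterval → Fin n → S2, IsLongitudinalMorph G p q H

/-- `X` is a choice of signed homogeneous coordinate vectors for the vertices: every `X i` is a
positive multiple of the point `p i`. -/
def IsHomogeneousCoordinates (p : Fin n → S2) (X : Fin n → E3) : Prop :=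
  ∀ i, ∃ r : ℝ, 0 < r ∧ X i = r • (p i : E3)

/-- A linear program (maximization) in real variables `z i`, with finitely many constraints
`ℓ z = b` and finitely many constraints `ℓ z ≥ b`. -/
structure LinearProgram (n : ℕ) where
  objective : (Fin n → ℝ) →ₗ[ℝ] ℝ
  eqs : Set (((Fin n → ℝ) →ₗ[ℝ] ℝ) × ℝ)
  eqs_finite : eqs.Finite
  ges : Set (((Fin n → ℝ) →ₗ[ℝ] ℝ) × ℝ)
  ges_finite : ges.Finite

/-- A linear program is feasible if some vector satisfies all of its constraints. -/
def LinearProgram.Feasible (L : LinearProgram n) : Prop :=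
  ∃ z : Fin n → ℝ, (∀ c ∈ L.eqs, c.1 z = c.2) ∧ ∀ c ∈ L.ges, c.2 ≤ c.1 z

/-- The determinant with rows `(x_i, y_i, z'_i)`, `(x_j, y_j, z'_j)`, `(x_k, y_k, z'_k)`, as a
linear function of the vector `z'`, where `x` and `y` are the first two coordinates of `X`. -/
def vol' (X : Fin n → E3) (i j k : Fin n) : (Fin n → ℝ) →ₗ[ℝ] ℝ where
  toFun z := Matrix.det !![X i 0, X i 1, z i; X j 0, X j 1, z j; X k 0, X k 1, z k]
  map_add' z w := by simp [Matrix.det_fin_three]; ring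
  map_smul' a z := by simp [Matrix.det_fin_three]; ring

/-- The linear program: maximize `∑ i, z' i` subject to `z' i = -1` for every vertex `i` of the
north face and `vol' i j k ≥ 0` for every non-polar face `(i, j, k)`. -/
def sinkLP (G : SimpleGraph (Fin n)) (p : Fin n → S2) (X : Fin n → E3) : LinearProgram n where
  objective := ∑ i, LinearMap.proj i
  eqs := (fun i => (LinearMap.proj i, -1)) '' {i | ∃ j k, IsNorthFace G p i j k}
  eqs_finite := Set.toFinite _
  ges := (fun f : Fin n × Fin n × Fin n => (vol' X f.1 f.2.1 f.2.2, 0)) ''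
    {f | IsNonPolarFace G p f.1 f.2.1 f.2.2}
  ges_finite := Set.toFinite _

end Drawings

end Sinking

end

noncomputable section

namespace Sinking


/-! All conditions depend only on directions, so the drawing is replaced by the cone over it in
space. Up to positive scaling, a vertex moving on its longitude is a vector whose horizontal part is
fixed and whose height varies. With horizontal parts fixed, each face determinant is affine along a
linear interpolation of the heights.

Necessity: suppose that the three vertices of a non-polar face become coplanar during a morph. By
`det3_smul_zAxis` they satisfy a linear relation whose coefficients are determinants of horizontal
parts, and the signs of these never change. Since no vertex lies on an edge of the other two, the
three signs agree; the triangle then winds around the axis, so the face contains a pole, a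
contradiction. Hence non-polar determinants stay positive (`IsLongitudinalMorph.det3_pos`). In the
final southern position some functional `α x + β y + γ z` with `γ > 0` equals `-1` on the suitably
scaled north face; its values as new heights multiply every determinant by `γ`, which gives a
feasible point.

Sufficiency: interpolate the heights linearly towards a feasible point. Non-polar determinants are
positive before time `1`. The key fact (`IsPositiveShift.lt_iff`) is that such a shift preserves the
order of the points of the drawing on every vertical line: consecutive points on the line are joined
by a segment inside one non-polar face, where the shift acts as a linear map preserving orientation
and the vertical direction. So the shifted drawings are embeddings and, in general position,
triangulations with the same faces. Every vertex lies on or below the boundary of the north face on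
its vertical line, so negative heights there force negative heights everywhere
(`neg_of_neg_northFace`). Stopping slightly before time `1` secures strict positivity and genericity
while the vertices are already southern. -/

/-! ### Determinants, cones over triangles and radial projection. -/

/-- The unit vector of the vertical axis. -/
def zAxis : E3 := !₂[0, 0, 1]

@[simp] lemma zAxis_zero : zAxis 0 = 0 := by simp [zAxis]
@[simp] lemma zAxis_one : zAxis 1 = 0 := by simp [zAxis]
@[simp] lemma zAxis_two : zAxis 2 = 1 := by simp [zAxis]

lemma coe_northPole : (northPole : E3) = zAxis := rfl

lemma coe_southPole : (southPole : E3) = -zAxis := by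
  ext m; fin_cases m <;> simp [southPole, zAxis]

/-- The determinant of the horizontal parts of two vectors. -/
def cross (u v : E3) : ℝ := u 0 * v 1 - u 1 * v 0

lemma ext3 {u v : E3} (h0 : u 0 = v 0) (h1 : u 1 = v 1) (h2 : u 2 = v 2) : u = v := by
  ext m; fin_cases m <;> assumption

lemma det3_eq (u v w : E3) : det3 u v w =
    u 0 * v 1 * w 2 - u 0 * v 2 * w 1 - u 1 * v 0 * w 2 + u 1 * v 2 * w 0 + u 2 * v 0 * w 1
      - u 2 * v 1 * w 0 := by
  simp [det3, Matrix.det_fin_three]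

lemma det3_rotate (u v w : E3) : det3 u v w = det3 v w u := by simp only [det3_eq]; ring

lemma det3_cramer (u v w s : E3) :
    det3 u v w • s = det3 s v w • u + det3 u s w • v + det3 u v s • w := by
  apply ext3 <;> simp [det3_eq] <;> ring

/-- Cramer's rule for the axis. The coefficients see only the horizontal parts, so for coplanar
vectors this is a linear relation whose signs are known. -/
lemma det3_smul_zAxis (u v w : E3) :
    det3 u v w • zAxis = cross v w • u + cross w u • v + cross u v • w := by
  apply ext3 <;> simp [det3_eq, cross] <;> ring

lemma det3_add_smul_fst (u v w s : E3) (a b : ℝ) :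
    det3 (a • u + b • s) v w = a * det3 u v w + b * det3 s v w := by
  simp [det3_eq]; ring

lemma det3_add_smul_snd (u v w s : E3) (a b : ℝ) :
    det3 u (a • v + b • s) w = a * det3 u v w + b * det3 u s w := by
  simp [det3_eq]; ring

lemma det3_add_smul_trd (u v w s : E3) (a b : ℝ) :
    det3 u v (a • w + b • s) = a * det3 u v w + b * det3 u v s := by
  simp [det3_eq]; ring

lemma det3_comb_fst (u v w : E3) (a b c : ℝ) :
    det3 (a • u + b • v + c • w) v w = a * det3 u v w := by
  simp [det3_eq]; ring

lemma det3_comb_snd (u v w : E3) (a b c : ℝ) :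
    det3 u (a • u + b • v + c • w) w = b * det3 u v w := by
  simp [det3_eq]; ring

lemma det3_comb_trd (u v w : E3) (a b c : ℝ) :
    det3 u v (a • u + b • v + c • w) = c * det3 u v w := by
  simp [det3_eq]; ring

lemma det3_add_zAxis_fst (v w s : E3) (h : ℝ) :
    det3 (s + h • zAxis) v w = det3 s v w + h * cross v w := by
  simp [det3_eq, cross]; ring

lemma det3_add_zAxis_snd (u w s : E3) (h : ℝ) :
    det3 u (s + h • zAxis) w = det3 u s w + h * cross w u := by
  simp [det3_eq, cross]; ring

lemma det3_add_zAxis_trd (u v s : E3) (h : ℝ) :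
    det3 u v (s + h • zAxis) = det3 u v s + h * cross u v := by
  simp [det3_eq, cross]; ring

lemma det3_smul_smul_smul (u v w : E3) (a b c : ℝ) :
    det3 (a • u) (b • v) (c • w) = a * b * c * det3 u v w := by
  simp [det3_eq]; ring

lemma eq_comb_of_det3_ne_zero {u v w : E3} (h : det3 u v w ≠ 0) (s : E3) :
    s = (det3 s v w / det3 u v w) • u + (det3 u s w / det3 u v w) • v
      + (det3 u v s / det3 u v w) • w := by
  have := congrArg (fun x => (det3 u v w)⁻¹ • x) (det3_cramer u v w s)
  simpa [smul_smul, h, div_eq_inv_mul] using this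

/-- The cone over the region to the left of the geodesic triangle with vertices in the directions
`u`, `v`, `w`. -/
def ccwCone (u v w : E3) : Set E3 :=
  {s | (0 < det3 u v w ∧ 0 < det3 s v w ∧ 0 < det3 u s w ∧ 0 < det3 u v s) ∨
    (det3 u v w < 0 ∧ (0 < det3 s v w ∨ 0 < det3 u s w ∨ 0 < det3 u v s))}

/-- By Cramer's rule the coordinates of `s` are quotients of determinants; dividing by a negative
determinant turns "outside the closed triangle" into "some determinant is positive". -/
lemma mem_ccwRegion {u v w s : S2} :
    s ∈ ccwRegion u v w ↔ (s : E3) ∈ ccwCone u v w := by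
  have key : ∀ h : det3 (u : E3) v w ≠ 0, ∀ a b c : ℝ, (s : E3) = a • (u : E3) + b • (v : E3) + c • (w : E3) →
      det3 (s : E3) v w = a * det3 (u : E3) v w ∧ det3 (u : E3) s w = b * det3 (u : E3) v w ∧
      det3 (u : E3) v s = c * det3 (u : E3) v w := by
    intro h a b c e
    rw [e]
    exact ⟨det3_comb_fst _ _ _ _ _ _, det3_comb_snd _ _ _ _ _ _, det3_comb_trd _ _ _ _ _ _⟩
  simp only [ccwRegion, ccwCone, Set.mem_ofPred_eq]
  refine or_congr (and_congr_right fun h => ?_) (and_congr_right fun h => ?_)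
  · constructor
    · rintro ⟨a, b, c, ha, hb, hc, e⟩
      obtain ⟨h1, h2, h3⟩ := key h.ne' a b c e
      rw [h1, h2, h3]
      exact ⟨by positivity, by positivity, by positivity⟩
    · rintro ⟨h1, h2, h3⟩
      exact ⟨_, _, _, div_pos h1 h, div_pos h2 h, div_pos h3 h, eq_comb_of_det3_ne_zero h.ne' _⟩
  · rw [← not_iff_not]
    push Not
    constructor
    · rintro ⟨a, b, c, ha, hb, hc, e⟩
      obtain ⟨h1, h2, h3⟩ := key h.ne a b c e
      rw [h1, h2, h3]
      exact ⟨mul_nonpos_of_nonneg_of_nonpos ha h.le, mul_nonpos_of_nonneg_of_nonpos hb h.le,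
        mul_nonpos_of_nonneg_of_nonpos hc h.le⟩
    · rintro ⟨h1, h2, h3⟩
      exact ⟨_, _, _, div_nonneg_of_nonpos h1 h.le, div_nonneg_of_nonpos h2 h.le,
        div_nonneg_of_nonpos h3 h.le, eq_comb_of_det3_ne_zero h.ne _⟩

lemma ccwCone_smul_iff {u v w s : E3} {a b c d : ℝ} (ha : 0 < a) (hb : 0 < b) (hc : 0 < c)
    (hd : 0 < d) : d • s ∈ ccwCone (a • u) (b • v) (c • w) ↔ s ∈ ccwCone u v w := by
  have neg_iff : ∀ {r x : ℝ}, 0 < r → (r * x < 0 ↔ x < 0) := fun hr =>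
    ⟨fun h => by by_contra h'; nlinarith [mul_nonneg hr.le (not_lt.1 h')],
      fun h => mul_neg_of_pos_of_neg hr h⟩
  simp only [ccwCone, Set.mem_ofPred_eq, det3_smul_smul_smul]
  rw [mul_pos_iff_of_pos_left (by positivity), mul_pos_iff_of_pos_left (by positivity),
    mul_pos_iff_of_pos_left (by positivity), mul_pos_iff_of_pos_left (by positivity),
    neg_iff (by positivity)]

/-- The radial projection to the unit sphere. -/
def toSphere (v : E3) : S2 :=
  -- The value at `0` is arbitrary.
  if h : v = 0 then northPole else ⟨‖v‖⁻¹ • v, by simp [norm_smul, h]⟩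

lemma coe_toSphere {v : E3} (h : v ≠ 0) : (toSphere v : E3) = ‖v‖⁻¹ • v := by
  simp [toSphere, h]

lemma S2.ne_zero (s : S2) : (s : E3) ≠ 0 := by
  intro h
  have := s.2
  simp [h] at this

lemma S2.norm_coe (s : S2) : ‖(s : E3)‖ = 1 := by
  simp

lemma toSphere_smul_coe (s : S2) {r : ℝ} (hr : 0 < r) : toSphere (r • (s : E3)) = s := by
  apply Subtype.ext
  rw [coe_toSphere (smul_ne_zero hr.ne' s.ne_zero), norm_smul, S2.norm_coe, smul_smul]
  simp [abs_of_pos hr, hr.ne']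

lemma toSphere_coe (s : S2) : toSphere (s : E3) = s := by
  simpa using toSphere_smul_coe s one_pos

lemma continuousOn_toSphere : ContinuousOn toSphere {0}ᶜ := by
  rw [continuousOn_iff_continuous_domRestrict, continuous_induced_rng]
  have : (Subtype.val ∘ Set.domRestrict {0}ᶜ toSphere) =
      fun v : ({0}ᶜ : Set E3) => ‖(v : E3)‖⁻¹ • (v : E3) := by
    ext1 v
    exact coe_toSphere v.2
  rw [this]
  exact (Continuous.inv₀ (by fun_prop) fun v => norm_ne_zero_iff.2 v.2).smul (by fun_prop)

lemma toSphere_mem_ccwRegion {u v w s : E3} (hu : u ≠ 0) (hv : v ≠ 0) (hw : w ≠ 0) (hs : s ≠ 0) :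
    toSphere s ∈ ccwRegion (toSphere u) (toSphere v) (toSphere w) ↔ s ∈ ccwCone u v w := by
  rw [mem_ccwRegion, coe_toSphere hu, coe_toSphere hv, coe_toSphere hw, coe_toSphere hs]
  exact ccwCone_smul_iff (by positivity) (by positivity) (by positivity) (by positivity)

lemma coe_mem_ccwCone {u v w : E3} {s : S2} (hu : u ≠ 0) (hv : v ≠ 0) (hw : w ≠ 0) :
    s ∈ ccwRegion (toSphere u) (toSphere v) (toSphere w) ↔ (s : E3) ∈ ccwCone u v w := by
  rw [← toSphere_mem_ccwRegion hu hv hw s.ne_zero, toSphere_coe]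

lemma mem_arc_toSphere {u v : E3} (hu : u ≠ 0) (hv : v ≠ 0) {s : S2} :
    s ∈ arc (toSphere u) (toSphere v) ↔
      ∃ a b : ℝ, 0 ≤ a ∧ 0 ≤ b ∧ (s : E3) = a • u + b • v := by
  simp only [arc, Set.mem_ofPred_eq, coe_toSphere hu, coe_toSphere hv]
  constructor
  · rintro ⟨a, b, ha, hb, h⟩
    exact ⟨a * ‖u‖⁻¹, b * ‖v‖⁻¹, by positivity, by positivity, by rw [h, mul_smul, mul_smul]⟩
  · rintro ⟨a, b, ha, hb, h⟩
    refine ⟨a * ‖u‖, b * ‖v‖, by positivity, by positivity, ?_⟩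
    have := norm_ne_zero_iff.2 hu
    have := norm_ne_zero_iff.2 hv
    rw [h, smul_smul, smul_smul]
    congr 2 <;> field_simp

lemma isOpen_ccwCone (u v w : E3) : IsOpen (ccwCone u v w) := by
  have c1 : Continuous fun s : E3 => det3 s v w := by simp only [det3_eq]; fun_prop
  have c2 : Continuous fun s : E3 => det3 u s w := by simp only [det3_eq]; fun_prop
  have c3 : Continuous fun s : E3 => det3 u v s := by simp only [det3_eq]; fun_prop
  have o1 := isOpen_lt continuous_const c1 (f := fun _ => (0 : ℝ))
  have o2 := isOpen_lt continuous_const c2 (f := fun _ => (0 : ℝ))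
  have o3 := isOpen_lt continuous_const c3 (f := fun _ => (0 : ℝ))
  exact (isOpen_const.inter (o1.inter (o2.inter o3))).union
    (isOpen_const.inter (o1.union (o2.union o3)))

lemma isOpen_ccwRegion (u v w : S2) : IsOpen (ccwRegion u v w) := by
  have : ccwRegion u v w = (Subtype.val : S2 → E3) ⁻¹' ccwCone u v w := by
    ext s; exact mem_ccwRegion
  rw [this]
  exact (isOpen_ccwCone _ _ _).preimage continuous_subtype_val

/-- A limit point of the region that lies outside the region is on one of the three sides. -/
lemma mem_arc_of_mem_closure_ccwRegion {u v w s : S2} (h : s ∈ closure (ccwRegion u v w))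
    (hs : s ∉ ccwRegion u v w) : s ∈ arc u v ∨ s ∈ arc v w ∨ s ∈ arc w u := by
  have c1 : Continuous fun s : S2 => det3 (s : E3) v w := by simp only [det3_eq]; fun_prop
  have c2 : Continuous fun s : S2 => det3 (u : E3) s w := by simp only [det3_eq]; fun_prop
  have c3 : Continuous fun s : S2 => det3 (u : E3) v s := by simp only [det3_eq]; fun_prop
  have k1 := isClosed_le continuous_const c1 (f := fun _ => (0 : ℝ))
  have k2 := isClosed_le continuous_const c2 (f := fun _ => (0 : ℝ))
  have k3 := isClosed_le continuous_const c3 (f := fun _ => (0 : ℝ))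
  have hne : det3 (u : E3) v w ≠ 0 := by
    intro h0
    have : ccwRegion u v w = ∅ := by
      ext t; simp [ccwRegion, h0]
    simp [this] at h
  -- Limits satisfy the weak inequalities and points outside fail the strict ones, so all
  -- coordinates are nonnegative and one of them vanishes.
  have key : 0 ≤ det3 (s : E3) v w / det3 (u : E3) v w ∧ 0 ≤ det3 (u : E3) s w / det3 (u : E3) v w ∧
      0 ≤ det3 (u : E3) v s / det3 (u : E3) v w ∧
      (det3 (s : E3) v w = 0 ∨ det3 (u : E3) s w = 0 ∨ det3 (u : E3) v s = 0) := by
    rw [mem_ccwRegion] at hs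
    simp only [ccwCone, Set.mem_ofPred_eq, not_or, not_and] at hs
    rcases hne.lt_or_gt with hD | hD
    · have hc : ccwRegion u v w ⊆ {s : S2 | 0 ≤ det3 (s : E3) v w ∨ 0 ≤ det3 (u : E3) s w ∨
          0 ≤ det3 (u : E3) v s} := by
        intro t ht
        rcases mem_ccwRegion.1 ht with ⟨h', -⟩ | ⟨-, h'⟩
        · exact absurd h' hD.not_gt
        · exact h'.imp le_of_lt (Or.imp le_of_lt le_of_lt)
      have h' := closure_minimal hc (k1.union (k2.union k3)) h
      obtain ⟨h1, h2, h3⟩ := hs.2 hD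
      push Not at h1 h2 h3
      refine ⟨div_nonneg_of_nonpos h1 hD.le, div_nonneg_of_nonpos h2 hD.le,
        div_nonneg_of_nonpos h3 hD.le, ?_⟩
      exact h'.imp (le_antisymm h1) (Or.imp (le_antisymm h2) (le_antisymm h3))
    · have hc : ccwRegion u v w ⊆ {s : S2 | 0 ≤ det3 (s : E3) v w ∧ 0 ≤ det3 (u : E3) s w ∧
          0 ≤ det3 (u : E3) v s} := by
        intro t ht
        rcases mem_ccwRegion.1 ht with ⟨-, h1, h2, h3⟩ | ⟨h', -⟩
        · exact ⟨h1.le, h2.le, h3.le⟩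
        · exact absurd h' hD.not_gt
      obtain ⟨h1, h2, h3⟩ := closure_minimal hc (k1.inter (k2.inter k3)) h
      refine ⟨div_nonneg h1 hD.le, div_nonneg h2 hD.le, div_nonneg h3 hD.le, ?_⟩
      by_contra hcon
      push Not at hcon
      exact hs.1 hD (lt_of_le_of_ne h1 hcon.1.symm) (lt_of_le_of_ne h2 hcon.2.1.symm)
        (lt_of_le_of_ne h3 hcon.2.2.symm)
  obtain ⟨ha, hb, hc, h0⟩ := key
  have e := eq_comb_of_det3_ne_zero hne (s : E3)
  rcases h0 with h0 | h0 | h0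
  · right; left
    exact ⟨_, _, hb, hc, by rw [h0] at e; simpa using e⟩
  · right; right
    refine ⟨_, _, hc, ha, by rw [h0] at e; rw [add_comm]; simpa using e⟩
  · left
    exact ⟨_, _, ha, hb, by rw [h0] at e; simpa using e⟩


/-! ### Great circles as linear dependence, and triangles winding around the axis. -/

lemma inner_eq (u v : E3) : inner ℝ u v = u 0 * v 0 + u 1 * v 1 + u 2 * v 2 := by
  simp [PiLp.inner_apply, Fin.sum_univ_three]; ring

lemma det3_eq_zero_iff {u v w : E3} : det3 u v w = 0 ↔
    ∃ ν : E3, ν ≠ 0 ∧ inner ℝ ν u = 0 ∧ inner ℝ ν v = 0 ∧ inner ℝ ν w = 0 := by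
  rw [det3, ← Matrix.exists_mulVec_eq_zero_iff]
  constructor
  · rintro ⟨ν, hν, h⟩
    refine ⟨WithLp.toLp 2 ν, by simpa using hν, ?_, ?_, ?_⟩
    · have := congrFun h 0
      simp [Matrix.mulVec, dotProduct, Fin.sum_univ_three] at this
      simp [inner_eq]; linarith
    · have := congrFun h 1
      simp [Matrix.mulVec, dotProduct, Fin.sum_univ_three] at this
      simp [inner_eq]; linarith
    · have := congrFun h 2
      simp [Matrix.mulVec, dotProduct, Fin.sum_univ_three] at this
      simp [inner_eq]; linarith
  · rintro ⟨ν, hν, h0, h1, h2⟩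
    rw [inner_eq] at h0 h1 h2
    refine ⟨ν.ofLp, by simpa using hν, ?_⟩
    ext m
    fin_cases m <;> simp [Matrix.mulVec, dotProduct, Fin.sum_univ_three] <;> linarith

/-- The condition says that `u`, `v` and the axis are coplanar; a normal of that plane is
horizontal. -/
lemma exists_horizontal_of_cross_eq_zero {u v : E3} (h : cross u v = 0) :
    ∃ ν : E3, ν ≠ 0 ∧ ν 2 = 0 ∧ inner ℝ ν u = 0 ∧ inner ℝ ν v = 0 := by
  have h' : det3 u v zAxis = 0 := by simpa [det3_eq, cross] using h
  obtain ⟨ν, hν, h0, h1, h2⟩ := det3_eq_zero_iff.1 h'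
  exact ⟨ν, hν, by simpa [inner_eq] using h2, h0, h1⟩

/-- The three vectors wind once around the vertical axis, counterclockwise if `σ = 1` and clockwise
if `σ = -1`. -/
def Winds (σ : ℝ) (u v w : E3) : Prop :=
  0 < σ * cross u v ∧ 0 < σ * cross v w ∧ 0 < σ * cross w u

lemma Winds.rotate {σ : ℝ} {u v w : E3} (h : Winds σ u v w) : Winds σ v w u :=
  ⟨h.2.1, h.2.2, h.1⟩

lemma ccwCone_rotate (u v w : E3) : ccwCone u v w = ccwCone v w u := by
  ext s
  simp only [ccwCone, Set.mem_ofPred_eq]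
  rw [det3_rotate u v w, det3_rotate s v w, det3_rotate u s w, det3_rotate u v s]
  tauto

/-- Moving in direction `σ` increases all three determinants, whichever way the triangle is
oriented. -/
lemma Winds.add_mem {σ : ℝ} {u v w s : E3} (hW : Winds σ u v w) (hs : s ∈ ccwCone u v w)
    {h : ℝ} (hh : 0 ≤ h) : s + (h * σ) • zAxis ∈ ccwCone u v w := by
  obtain ⟨h1, h2, h3⟩ := hW
  have k1 := mul_nonneg hh h1.le
  have k2 := mul_nonneg hh h2.le
  have k3 := mul_nonneg hh h3.le
  simp only [ccwCone, Set.mem_ofPred_eq, det3_add_zAxis_fst, det3_add_zAxis_snd,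
    det3_add_zAxis_trd, mul_assoc] at hs ⊢
  rcases hs with ⟨hD, a, b, c⟩ | ⟨hD, hs⟩
  · exact Or.inl ⟨hD, by linarith, by linarith, by linarith⟩
  · refine Or.inr ⟨hD, ?_⟩
    rcases hs with a | a | a
    · left; linarith
    · right; left; linarith
    · right; right; linarith

/-- On a side the determinant of the opposite vertex vanishes, so off the side its sign is that of
`h`. A side thus cuts its vertical line into a ray inside the region and a ray outside. -/
lemma Winds.side_add_mem_iff {σ : ℝ} {u v w : E3} (hW : Winds σ u v w) (hD : det3 u v w ≠ 0)
    {a b h : ℝ} (ha : 0 ≤ a) (hb : 0 ≤ b) :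
    a • u + b • v + (h * σ) • zAxis ∈ ccwCone u v w ↔ 0 < h := by
  obtain ⟨h1, h2, h3⟩ := hW
  have e1 : det3 (a • u + b • v) v w = a * det3 u v w := by
    simpa using det3_comb_fst u v w a b 0
  have e2 : det3 u (a • u + b • v) w = b * det3 u v w := by
    simpa using det3_comb_snd u v w a b 0
  have e3 : det3 u v (a • u + b • v) = 0 := by
    simpa using det3_comb_trd u v w a b 0
  simp only [ccwCone, Set.mem_ofPred_eq, det3_add_zAxis_fst, det3_add_zAxis_snd,
    det3_add_zAxis_trd, mul_assoc, e1, e2, e3, zero_add]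
  rw [mul_pos_iff_of_pos_right h1]
  constructor
  · rintro (⟨-, -, -, k⟩ | ⟨hD, k⟩)
    · exact k
    · rcases k with k | k | k
      · by_contra hh
        nlinarith [mul_nonneg (neg_nonneg.2 (not_lt.1 hh)) h2.le]
      · by_contra hh
        nlinarith [mul_nonneg (neg_nonneg.2 (not_lt.1 hh)) h3.le]
      · exact k
  · intro hh
    rcases hD.lt_or_gt with hD | hD
    · exact Or.inr ⟨hD, Or.inr (Or.inr hh)⟩
    · have := mul_nonneg ha hD.le
      have := mul_nonneg hb hD.le
      have := mul_pos hh h2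
      have := mul_pos hh h3
      exact Or.inl ⟨hD, by linarith, by linarith, hh⟩

/-- Every vertical line meets one of the sides of a triangle that winds around the axis. -/
lemma Winds.exists_side {σ : ℝ} {u v w : E3} (hW : Winds σ u v w)
    (hD : det3 u v w ≠ 0) (s : E3) : ∃ h a b : ℝ, 0 ≤ a ∧ 0 ≤ b ∧
      (s + h • zAxis = a • u + b • v ∨ s + h • zAxis = a • v + b • w ∨
        s + h • zAxis = a • w + b • u) := by
  set D := det3 u v w with hDdef
  obtain ⟨h1, h2, h3⟩ := hW
  -- Scaling the height by `σ * D` makes each coordinate grow with `t` at a positive rate.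
  have e : ∀ t : ℝ, s + (t * (σ * D)) • zAxis =
      ((det3 s v w / D) + t * (σ * cross v w)) • u + ((det3 u s w / D) + t * (σ * cross w u)) • v
        + ((det3 u v s / D) + t * (σ * cross u v)) • w := by
    intro t
    have := eq_comb_of_det3_ne_zero hD (s + (t * (σ * D)) • zAxis)
    rw [det3_add_zAxis_fst, det3_add_zAxis_snd, det3_add_zAxis_trd, ← hDdef] at this
    rw [this]
    congr 1
    · congr 1 <;> congr 1 <;> field_simp
    · congr 1; field_simp
  generalize det3 s v w / D = α at e
  generalize det3 u s w / D = β at e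
  generalize det3 u v s / D = γ at e
  generalize σ * cross v w = x at *
  generalize σ * cross w u = y at *
  generalize σ * cross u v = z at *
  have key : ∀ {α β x y t : ℝ}, 0 < x → 0 < y → β * x ≥ α * y → t = -α / x →
      0 ≤ β + t * y := by
    intro α β x y t hx hy h ht
    have : β + t * y = (β * x - α * y) / x := by rw [ht]; field_simp; ring
    rw [this]
    exact div_nonneg (by linarith) hx.le
  have zero : ∀ {α x : ℝ}, 0 < x → α + -α / x * x = 0 := by
    intro α x hx; field_simp; ring
  have first : ∀ {α β γ x y z : ℝ}, 0 < x → 0 < y → 0 < z →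
      (α / x ≤ β / y ∧ α / x ≤ γ / z) ∨ (β / y ≤ α / x ∧ β / y ≤ γ / z) ∨
      (γ / z ≤ α / x ∧ γ / z ≤ β / y) := by
    intro α β γ x y z _ _ _
    grind
  -- The coordinate with the smallest ratio of value to rate is the last to become zero as `t`
  -- increases; at that `t` the other two are nonnegative.
  rcases first (α := α) (β := β) (γ := γ) h2 h3 h1 with ⟨a, b⟩ | ⟨a, b⟩ | ⟨a, b⟩
  · rw [div_le_div_iff₀ h2 h3] at a
    rw [div_le_div_iff₀ h2 h1] at b
    have := e (-α / x)
    rw [zero h2, zero_smul, zero_add] at this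
    exact ⟨_, _, _, key h2 h3 a rfl, key h2 h1 b rfl, Or.inr (Or.inl this)⟩
  · rw [div_le_div_iff₀ h3 h2] at a
    rw [div_le_div_iff₀ h3 h1] at b
    have := e (-β / y)
    rw [zero h3, zero_smul, add_zero, add_comm (_ • u)] at this
    exact ⟨_, _, _, key h3 h1 b rfl, key h3 h2 a rfl, Or.inr (Or.inr this)⟩
  · rw [div_le_div_iff₀ h1 h2] at a
    rw [div_le_div_iff₀ h1 h3] at b
    have := e (-γ / z)
    rw [zero h1, zero_smul, add_zero] at this
    exact ⟨_, _, _, key h1 h2 a rfl, key h1 h3 b rfl, Or.inl this⟩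

/-! ### Consequences of genericity, cones over drawings, and polar faces. -/

section Triangulation

variable {n : ℕ} {G : SimpleGraph (Fin n)} {p : Fin n → S2}

lemma IsGenericTriangulation.det3_ne_zero (hp : IsGenericTriangulation G p) {i j k : Fin n}
    (hij : i ≠ j) (hjk : j ≠ k) (hki : k ≠ i) : det3 (p i : E3) (p j) (p k) ≠ 0 := by
  intro h
  obtain ⟨ν, hν, h0, h1, h2⟩ := det3_eq_zero_iff.1 h
  have := hp.generic ν hν
  have h3 : ({i, j, k} : Set (Fin n)) ⊆ {m | p m ∈ greatCircle ν} := by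
    rintro m (rfl | rfl | rfl) <;> assumption
  have := (Set.ncard_le_ncard h3).trans this
  rw [Set.ncard_eq_three.2 ⟨i, j, k, hij, hki.symm, hjk, rfl⟩] at this
  omega

lemma IsGenericTriangulation.cross_ne_zero (hp : IsGenericTriangulation G p) {i j : Fin n}
    (hij : i ≠ j) : cross (p i : E3) (p j) ≠ 0 := by
  intro h
  obtain ⟨ν, hν, h2, h0, h1⟩ := exists_horizontal_of_cross_eq_zero h
  have := hp.generic_pole ν hν (by simp [greatCircle, coe_northPole, inner_eq, h2])
    (by simp [greatCircle, coe_southPole, inner_eq, h2])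
  have h3 : ({i, j} : Set (Fin n)) ⊆ {m | p m ∈ greatCircle ν} := by
    rintro m (rfl | rfl) <;> assumption
  have := (Set.ncard_le_ncard h3).trans this
  rw [Set.ncard_pair hij] at this
  omega

lemma IsGenericTriangulation.horizontal_ne_zero (hn : 4 ≤ n) (hp : IsGenericTriangulation G p)
    (i : Fin n) : (p i : E3) 0 ≠ 0 ∨ (p i : E3) 1 ≠ 0 := by
  have : Nontrivial (Fin n) := Fin.nontrivial_iff_two_le.2 (by omega)
  obtain ⟨j, hj⟩ := exists_ne i
  have := hp.cross_ne_zero hj.symm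
  by_contra! h
  exact this (by simp [cross, h])

/-- A linear relation between the horizontal parts of two vertices is trivial. -/
lemma IsGenericTriangulation.comb_eq_zero (hn : 4 ≤ n) (hp : IsGenericTriangulation G p)
    {i j : Fin n} {a b : ℝ} (h0 : a * (p i : E3) 0 + b * (p j : E3) 0 = 0)
    (h1 : a * (p i : E3) 1 + b * (p j : E3) 1 = 0) (R : Fin n → E3) : a • R i + b • R j = 0 := by
  by_cases hij : i = j
  · subst hij
    have : a + b = 0 := by
      rcases hp.horizontal_ne_zero hn i with h | h
      · rw [← add_mul] at h0
        exact (mul_eq_zero.1 h0).resolve_right h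
      · rw [← add_mul] at h1
        exact (mul_eq_zero.1 h1).resolve_right h
    rw [← add_smul, this, zero_smul]
  · have hc := hp.cross_ne_zero hij
    have ha : a * cross (p i : E3) (p j) = 0 := by
      simp only [cross]
      linear_combination (p j : E3) 1 * h0 - (p j : E3) 0 * h1
    have hb : b * cross (p i : E3) (p j) = 0 := by
      simp only [cross]
      linear_combination (p i : E3) 0 * h1 - (p i : E3) 1 * h0
    rw [(mul_eq_zero.1 ha).resolve_right hc, (mul_eq_zero.1 hb).resolve_right hc]
    simp

/-- The cone over a drawing with vertices in the directions `P i`. -/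
def coneDrawing (G : SimpleGraph (Fin n)) (P : Fin n → E3) : Set E3 :=
  {w | ∃ i j, (G.Adj i j ∨ i = j) ∧ ∃ a b : ℝ, 0 ≤ a ∧ 0 ≤ b ∧ w = a • P i + b • P j}

lemma smul_mem_coneDrawing {P : Fin n → E3} {w : E3} (hw : w ∈ coneDrawing G P) {r : ℝ}
    (hr : 0 ≤ r) : r • w ∈ coneDrawing G P := by
  obtain ⟨i, j, hij, a, b, ha, hb, rfl⟩ := hw
  exact ⟨i, j, hij, r * a, r * b, by positivity, by positivity, by
    rw [smul_add, smul_smul, smul_smul]⟩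

lemma smul_mem_coneDrawing_iff {P : Fin n → E3} {w : E3} {r : ℝ} (hr : 0 < r) :
    r • w ∈ coneDrawing G P ↔ w ∈ coneDrawing G P := by
  refine ⟨fun h => ?_, fun h => smul_mem_coneDrawing h hr.le⟩
  simpa [smul_smul, hr.ne'] using smul_mem_coneDrawing h (inv_nonneg.2 hr.le)

lemma mem_arc_self {u w : S2} : w ∈ arc u u ↔ w = u := by
  constructor
  · rintro ⟨a, b, ha, hb, h⟩
    rw [← add_smul] at h
    have hab : 0 < a + b := by
      refine lt_of_le_of_ne (add_nonneg ha hb) fun h0 => w.ne_zero ?_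
      rw [h, ← h0, zero_smul]
    rw [← toSphere_coe w, h, toSphere_smul_coe u hab]
  · rintro rfl
    exact ⟨1, 0, zero_le_one, le_rfl, by simp⟩

lemma mem_drawing_toSphere {P : Fin n → E3} (hP : ∀ i, P i ≠ 0) {w : S2} :
    w ∈ drawing G (fun i => toSphere (P i)) ↔ (w : E3) ∈ coneDrawing G P := by
  simp only [drawing, coneDrawing, Set.mem_ofPred_eq, ← mem_arc_toSphere (hP _) (hP _)]
  constructor
  · rintro (⟨i, hi⟩ | ⟨i, j, hij, h⟩)
    · exact ⟨i, i, Or.inr rfl, mem_arc_self.2 hi⟩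
    · exact ⟨i, j, Or.inl hij, h⟩
  · rintro ⟨i, j, hij | rfl, h⟩
    · exact Or.inr ⟨i, j, hij, h⟩
    · exact Or.inl ⟨i, mem_arc_self.1 h⟩

lemma mem_drawing {w : S2} :
    w ∈ drawing G p ↔ (w : E3) ∈ coneDrawing G (fun i => (p i : E3)) := by
  rw [← mem_drawing_toSphere fun i => (p i).ne_zero]
  simp only [toSphere_coe]

lemma toSphere_mem_drawing {w : E3} (hw : w ≠ 0) :
    toSphere w ∈ drawing G p ↔ w ∈ coneDrawing G (fun i => (p i : E3)) := by
  rw [mem_drawing, coe_toSphere hw, smul_mem_coneDrawing_iff (by positivity)]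

lemma zero_notMem_ccwCone (u v w : E3) : (0 : E3) ∉ ccwCone u v w := by
  simp [ccwCone, det3_eq]

lemma ne_zero_of_mem_ccwCone {u v w s : E3} (h : s ∈ ccwCone u v w) : s ≠ 0 := by
  rintro rfl
  exact zero_notMem_ccwCone _ _ _ h

lemma toSphere_mem_ccwRegion_coe {u v w : S2} {s : E3} (hs : s ≠ 0) :
    toSphere s ∈ ccwRegion u v w ↔ s ∈ ccwCone (u : E3) v w := by
  simpa only [toSphere_coe] using toSphere_mem_ccwRegion u.ne_zero v.ne_zero w.ne_zero hs

lemma IsFace.notMem_coneDrawing {i j k : Fin n} (hf : IsFace G p i j k) {w : E3}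
    (hw : w ∈ ccwCone (p i : E3) (p j) (p k)) : w ∉ coneDrawing G (fun i => (p i : E3)) := by
  obtain ⟨-, -, -, x, hx, h⟩ := hf
  have hw0 := ne_zero_of_mem_ccwCone hw
  rw [← toSphere_mem_drawing hw0]
  rw [← toSphere_mem_ccwRegion_coe hw0, h] at hw
  exact connectedComponentIn_subset _ _ hw

lemma IsFace.rotate {i j k : Fin n} (hf : IsFace G p i j k) : IsFace G p j k i := by
  obtain ⟨h1, h2, h3, h⟩ := hf
  refine ⟨h2, h3, h1, ?_⟩
  have : ccwRegion (p j) (p k) (p i) = ccwRegion (p i) (p j) (p k) := by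
    ext s
    rw [mem_ccwRegion, mem_ccwRegion, ← ccwCone_rotate]
  rwa [this]

lemma IsFace.det3_ne_zero (hp : IsGenericTriangulation G p) {i j k : Fin n}
    (hf : IsFace G p i j k) : det3 (p i : E3) (p j) (p k) ≠ 0 :=
  hp.det3_ne_zero hf.1.ne hf.2.1.ne hf.2.2.1.ne

/-- A connected set of directions that avoids the drawing lies in a face. -/
lemma IsGenericTriangulation.exists_face (hp : IsGenericTriangulation G p) {K : Set E3}
    (hK : IsPreconnected K) (hne : K.Nonempty)
    (h : ∀ w ∈ K, w ≠ 0 ∧ w ∉ coneDrawing G (fun i => (p i : E3))) :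
    ∃ i j k, IsFace G p i j k ∧ K ⊆ ccwCone (p i : E3) (p j) (p k) := by
  obtain ⟨w, hw⟩ := hne
  have hK' : IsPreconnected (toSphere '' K) :=
    hK.image _ (continuousOn_toSphere.mono fun w hw => (h w hw).1)
  have hsub : toSphere '' K ⊆ (drawing G p)ᶜ := by
    rintro _ ⟨v, hv, rfl⟩
    rw [Set.mem_compl_iff, toSphere_mem_drawing (h v hv).1]
    exact (h v hv).2
  have hF : IsFaceSet G p (connectedComponentIn (drawing G p)ᶜ (toSphere w)) :=
    ⟨_, hsub ⟨w, hw, rfl⟩, rfl⟩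
  obtain ⟨i, j, k, h1, h2, h3, e⟩ := hp.triangular _ hF
  refine ⟨i, j, k, ⟨h1, h2, h3, e ▸ hF⟩, fun v hv => ?_⟩
  rw [← toSphere_mem_ccwRegion_coe (h v hv).1, ← e]
  exact hK'.subset_connectedComponentIn ⟨w, hw, rfl⟩ hsub ⟨v, hv, rfl⟩

lemma IsGenericTriangulation.zAxis_notMem (hn : 4 ≤ n) (hp : IsGenericTriangulation G p) {r : ℝ}
    (hr : r ≠ 0) : r • zAxis ∉ coneDrawing G (fun i => (p i : E3)) := by
  rintro ⟨i, j, -, a, b, -, -, h⟩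
  have h0 := congrArg (fun v : E3 => v 0) h
  have h1 := congrArg (fun v : E3 => v 1) h
  simp at h0 h1
  have h := h.trans (hp.comb_eq_zero hn h0.symm h1.symm fun i => (p i : E3))
  have h2 := congrArg (fun v : E3 => v 2) h
  simp at h2
  exact hr h2

lemma IsGenericTriangulation.exists_face_pole (hn : 4 ≤ n) (hp : IsGenericTriangulation G p)
    {r : ℝ} (hr : r ≠ 0) :
    ∃ i j k, IsFace G p i j k ∧ r • zAxis ∈ ccwCone (p i : E3) (p j) (p k) := by
  obtain ⟨i, j, k, hf, h⟩ := hp.exists_face (K := {r • zAxis}) isPreconnected_singleton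
    (Set.singleton_nonempty _) (by
      rintro w rfl
      refine ⟨fun h => hr ?_, hp.zAxis_notMem hn hr⟩
      simpa using congrArg (fun v : E3 => v 2) h)
  exact ⟨i, j, k, hf, h rfl⟩

/-- `(i, j, k)` is a face around the pole `(0, 0, σ)`. -/
def IsPolarFace (σ : ℝ) (G : SimpleGraph (Fin n)) (p : Fin n → S2) (i j k : Fin n) : Prop :=
  IsFace G p i j k ∧ σ • zAxis ∈ ccwCone (p i : E3) (p j) (p k)

lemma isNorthFace_iff {i j k : Fin n} : IsNorthFace G p i j k ↔ IsPolarFace 1 G p i j k := by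
  rw [IsNorthFace, IsPolarFace, mem_ccwRegion, coe_northPole, one_smul]

lemma isSouthFace_iff {i j k : Fin n} : IsSouthFace G p i j k ↔ IsPolarFace (-1) G p i j k := by
  rw [IsSouthFace, IsPolarFace, mem_ccwRegion, coe_southPole, neg_one_smul]

lemma smul_zAxis_mem_ccwCone {σ : ℝ} {u v w : E3} : σ • zAxis ∈ ccwCone u v w ↔
    (0 < det3 u v w ∧ 0 < σ * cross v w ∧ 0 < σ * cross w u ∧ 0 < σ * cross u v) ∨
    (det3 u v w < 0 ∧ (0 < σ * cross v w ∨ 0 < σ * cross w u ∨ 0 < σ * cross u v)) := by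
  have e1 : det3 (σ • zAxis) v w = σ * cross v w := by simp [det3_eq, cross]; ring
  have e2 : det3 u (σ • zAxis) w = σ * cross w u := by simp [det3_eq, cross]; ring
  have e3 : det3 u v (σ • zAxis) = σ * cross u v := by simp [det3_eq, cross]; ring
  simp only [ccwCone, Set.mem_ofPred_eq, e1, e2, e3]

/-- For a positively oriented face, containing the pole is the winding condition. For a negatively
oriented one, each of the three signs is forced by the absence of the other pole. -/
lemma IsPolarFace.winds (hp : IsGenericTriangulation G p) {σ : ℝ} (hσ : σ ≠ 0) {i j k : Fin n}
    (h : IsPolarFace σ G p i j k) (h' : ¬ IsPolarFace (-σ) G p i j k) :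
    Winds σ (p i : E3) (p j) (p k) := by
  have hf := h.1
  have c1 := mul_ne_zero hσ (hp.cross_ne_zero hf.1.ne)
  have c2 := mul_ne_zero hσ (hp.cross_ne_zero hf.2.1.ne)
  have c3 := mul_ne_zero hσ (hp.cross_ne_zero hf.2.2.1.ne)
  have h' : ¬ (-σ) • zAxis ∈ ccwCone (p i : E3) (p j) (p k) := fun hh => h' ⟨hf, hh⟩
  have h := h.2
  rw [smul_zAxis_mem_ccwCone] at h h'
  rcases h with ⟨-, h1, h2, h3⟩ | ⟨hD, -⟩
  · exact ⟨h3, h1, h2⟩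
  · push Not at h'
    obtain ⟨h1, h2, h3⟩ := h'.2 hD
    exact ⟨lt_of_le_of_ne (by linarith) c1.symm, lt_of_le_of_ne (by linarith) c2.symm,
      lt_of_le_of_ne (by linarith) c3.symm⟩

/-- A negatively oriented face is the complement of a small triangle; the sign of a single `cross`
already places one of the poles in it. -/
lemma IsNonPolarFace.det3_pos (hp : IsGenericTriangulation G p) {i j k : Fin n}
    (h : IsNonPolarFace G p i j k) : 0 < det3 (p i : E3) (p j) (p k) := by
  obtain ⟨hf, h1, h2⟩ := h
  rw [isNorthFace_iff] at h1
  rw [isSouthFace_iff] at h2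
  by_contra hD
  have hD := lt_of_le_of_ne (not_lt.1 hD) (hf.det3_ne_zero hp)
  rcases (hp.cross_ne_zero hf.1.ne).lt_or_gt with h | h
  · exact h2 ⟨hf, smul_zAxis_mem_ccwCone.2 (Or.inr ⟨hD, by right; right; linarith⟩)⟩
  · exact h1 ⟨hf, smul_zAxis_mem_ccwCone.2 (Or.inr ⟨hD, by right; right; linarith⟩)⟩

end Triangulation


/-! ### Vertical shifts and the order of the drawing on vertical lines. -/

/-- Induction on the number of points of `S` strictly between `a` and `b`. It reduces statements
about a vertical line to consecutive points of the drawing. -/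
lemma chain_induction {S : Set ℝ} (hS : S.Finite) {R : ℝ → ℝ → Prop}
    (step : ∀ a b, a ∈ S → b ∈ S → a < b → (∀ c, a < c → c < b → c ∉ S) → R a b)
    (trans : ∀ a b c, a ∈ S → b ∈ S → c ∈ S → a < b → b < c → R a b → R b c → R a c)
    {a b : ℝ} (ha : a ∈ S) (hb : b ∈ S) (hab : a < b) : R a b := by
  induction hm : (S ∩ Set.Ioo a b).ncard using Nat.strong_induction_on generalizing a b with
  | _ m ih =>
    by_cases h : ∀ c, a < c → c < b → c ∉ S
    · exact step a b ha hb hab h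
    · push Not at h
      obtain ⟨c, hac, hcb, hc⟩ := h
      have fin : (S ∩ Set.Ioo a b).Finite := hS.subset Set.inter_subset_left
      have h1 : (S ∩ Set.Ioo a c).ncard < m := by
        rw [← hm]
        refine Set.ncard_lt_ncard ⟨fun x hx => ⟨hx.1, hx.2.1, hx.2.2.trans hcb⟩, fun hsub => ?_⟩ fin
        exact (hsub ⟨hc, hac, hcb⟩).2.2.false
      have h2 : (S ∩ Set.Ioo c b).ncard < m := by
        rw [← hm]
        refine Set.ncard_lt_ncard ⟨fun x hx => ⟨hx.1, hac.trans hx.2.1, hx.2.2⟩, fun hsub => ?_⟩ fin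
        exact (hsub ⟨hc, hac, hcb⟩).2.1.false
      exact trans a c b ha hc hb hac hcb (ih _ h1 ha hc hac rfl) (ih _ h2 hc hb hcb rfl)

section Triangulation

variable {n : ℕ} {G : SimpleGraph (Fin n)} {p : Fin n → S2} {Q : Fin n → E3}

/-- The point `w` of the cone over the drawing `p` is carried to `v` when every vertex `p i` is
replaced by `Q i`, linearly along edges. -/
def Lifts (G : SimpleGraph (Fin n)) (p : Fin n → S2) (Q : Fin n → E3) (w v : E3) : Prop :=
  ∃ i j, (G.Adj i j ∨ i = j) ∧ ∃ a b : ℝ, 0 ≤ a ∧ 0 ≤ b ∧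
    w = a • (p i : E3) + b • (p j : E3) ∧ v = a • Q i + b • Q j

lemma exists_lifts {w : E3} (h : w ∈ coneDrawing G (fun i => (p i : E3))) (Q : Fin n → E3) :
    ∃ v, Lifts G p Q w v := by
  obtain ⟨i, j, hij, a, b, ha, hb, rfl⟩ := h
  exact ⟨_, i, j, hij, a, b, ha, hb, rfl, rfl⟩

lemma exists_lifts_of_mem {v : E3} (h : v ∈ coneDrawing G Q) : ∃ w, Lifts G p Q w v := by
  obtain ⟨i, j, hij, a, b, ha, hb, rfl⟩ := h
  exact ⟨_, i, j, hij, a, b, ha, hb, rfl, rfl⟩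

lemma Lifts.mem {w v : E3} (h : Lifts G p Q w v) : w ∈ coneDrawing G (fun i => (p i : E3)) := by
  obtain ⟨i, j, hij, a, b, ha, hb, rfl, rfl⟩ := h
  exact ⟨i, j, hij, a, b, ha, hb, rfl⟩

lemma Lifts.mem_right {w v : E3} (h : Lifts G p Q w v) : v ∈ coneDrawing G Q := by
  obtain ⟨i, j, hij, a, b, ha, hb, rfl, rfl⟩ := h
  exact ⟨i, j, hij, a, b, ha, hb, rfl⟩

lemma lifts_edge {i j : Fin n} (hij : G.Adj i j) {a b : ℝ} (ha : 0 ≤ a) (hb : 0 ≤ b) :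
    Lifts G p Q (a • (p i : E3) + b • (p j : E3)) (a • Q i + b • Q j) :=
  ⟨i, j, Or.inl hij, a, b, ha, hb, rfl, rfl⟩

lemma lifts_vertex (i : Fin n) {a : ℝ} (ha : 0 ≤ a) :
    Lifts G p Q (a • (p i : E3)) (a • Q i) :=
  ⟨i, i, Or.inr rfl, a, 0, ha, le_rfl, by simp, by simp⟩

lemma lifts_boundary {i j k : Fin n} (hij : G.Adj i j) (hjk : G.Adj j k) (hki : G.Adj k i)
    {a b c : ℝ} (ha : 0 ≤ a) (hb : 0 ≤ b) (hc : 0 ≤ c) (h0 : a = 0 ∨ b = 0 ∨ c = 0) :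
    Lifts G p Q (a • (p i : E3) + b • (p j : E3) + c • (p k : E3))
      (a • Q i + b • Q j + c • Q k) := by
  rcases h0 with rfl | rfl | rfl
  · simpa using lifts_edge hjk hb hc
  · simpa [add_comm] using lifts_edge hki hc ha
  · simpa using lifts_edge hij ha hb

lemma mem_arc_of_eq_smul {u v : S2} {w : E3} {a b : ℝ} (ha : 0 ≤ a) (hb : 0 ≤ b) (hw : w ≠ 0)
    (h : w = a • (u : E3) + b • (v : E3)) : toSphere w ∈ arc u v :=
  ⟨‖w‖⁻¹ * a, ‖w‖⁻¹ * b, by positivity, by positivity, by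
    rw [coe_toSphere hw, mul_smul, mul_smul, ← smul_add, ← h]⟩

/-- Merges the clauses of the embedding by treating a vertex as the degenerate edge `i = j`. -/
lemma IsShortestPathEmbedding.common (he : IsShortestPathEmbedding G p) {i j k l : Fin n}
    (hij : G.Adj i j ∨ i = j) (hkl : G.Adj k l ∨ k = l) {w : S2} (h1 : w ∈ arc (p i) (p j))
    (h2 : w ∈ arc (p k) (p l)) : (i = k ∧ j = l) ∨ (i = l ∧ j = k) ∨
      ∃ m, (m = i ∨ m = j) ∧ (m = k ∨ m = l) ∧ w = p m := by
  rcases hij with hij | rfl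
  · rcases hkl with hkl | rfl
    · by_cases h : s(i, j) = s(k, l)
      · rcases Sym2.eq_iff.1 h with h | h
        · exact Or.inl h
        · exact Or.inr (Or.inl h)
      · exact Or.inr (Or.inr (he.edge_edge i j k l hij hkl h w h1 h2))
    · rw [mem_arc_self] at h2
      subst h2
      exact Or.inr (Or.inr ⟨k, he.vertex_edge i j k hij h1, Or.inl rfl, rfl⟩)
  · rw [mem_arc_self] at h1
    subst h1
    rcases hkl with hkl | rfl
    · exact Or.inr (Or.inr ⟨i, Or.inl rfl, he.vertex_edge k l i hkl h2, rfl⟩)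
    · rw [mem_arc_self] at h2
      exact Or.inl ⟨he.injective h2, he.injective h2⟩

/-- Relations between combinations of two vertices carry over. -/
lemma IsGenericTriangulation.comb_congr (hn : 4 ≤ n) (hp : IsGenericTriangulation G p)
    {i j : Fin n} {a b c d : ℝ}
    (h : a • (p i : E3) + b • (p j : E3) = c • (p i : E3) + d • (p j : E3)) (R : Fin n → E3) :
    a • R i + b • R j = c • R i + d • R j := by
  have h0 := congrArg (fun v : E3 => v 0) h
  have h1 := congrArg (fun v : E3 => v 1) h
  simp at h0 h1
  have := hp.comb_eq_zero hn (i := i) (j := j) (a := a - c) (b := b - d) (by linarith)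
    (by linarith) R
  rw [← sub_eq_zero, ← this]
  module

lemma IsGenericTriangulation.comb_congr_vertex (hn : 4 ≤ n) (hp : IsGenericTriangulation G p)
    {i j m : Fin n} (hm : m = i ∨ m = j) {a b c : ℝ}
    (h : a • (p i : E3) + b • (p j : E3) = c • (p m : E3)) (R : Fin n → E3) :
    a • R i + b • R j = c • R m := by
  rcases hm with rfl | rfl
  · simpa using hp.comb_congr hn (c := c) (d := 0) (by simpa using h) R
  · simpa using hp.comb_congr hn (c := 0) (d := c) (by simpa using h) R

/-- Different edges share only multiples of a common vertex, and on a single edge the coefficients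
are determined by the horizontal parts. So the lift is a well-defined map on the drawing. -/
lemma Lifts.unique (hn : 4 ≤ n) (hp : IsGenericTriangulation G p) {w v v' : E3}
    (h : Lifts G p Q w v) (h' : Lifts G p Q w v') : v = v' := by
  obtain ⟨i, j, hij, a, b, ha, hb, hw, rfl⟩ := h
  obtain ⟨k, l, hkl, c, d, hc, hd, hw', rfl⟩ := h'
  have hww := hw.symm.trans hw'
  by_cases h0 : w = 0
  · have z1 := hp.comb_congr hn (i := i) (j := j) (a := a) (b := b) (c := 0) (d := 0)
      (by simp [← hw, h0]) Q
    have z2 := hp.comb_congr hn (i := k) (j := l) (a := c) (b := d) (c := 0) (d := 0)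
      (by simp [← hw', h0]) Q
    rw [z1, z2]; simp
  rcases hp.embedding.common hij hkl (mem_arc_of_eq_smul ha hb h0 hw)
    (mem_arc_of_eq_smul hc hd h0 hw') with ⟨rfl, rfl⟩ | ⟨rfl, rfl⟩ | ⟨m, hm, hm', e⟩
  · exact hp.comb_congr hn hww Q
  · rw [add_comm (c • _)] at hww ⊢
    exact hp.comb_congr hn hww Q
  · have e : w = ‖w‖ • (p m : E3) := by
      rw [← e, coe_toSphere h0, smul_smul, mul_inv_cancel₀ (norm_ne_zero_iff.2 h0), one_smul]
    rw [hp.comb_congr_vertex hn hm (hw.symm.trans e) Q,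
      hp.comb_congr_vertex hn hm' (hw'.symm.trans e) Q]

/-- The points where a vertical line meets the drawing are finite in number. -/
lemma IsGenericTriangulation.finite_line (hn : 4 ≤ n) (hp : IsGenericTriangulation G p) (w : E3) :
    {h : ℝ | w + h • zAxis ∈ coneDrawing G (fun i => (p i : E3))}.Finite := by
  have : {h : ℝ | w + h • zAxis ∈ coneDrawing G (fun i => (p i : E3))} ⊆
      ⋃ i, ⋃ j, {h : ℝ | ∃ a b : ℝ, w + h • zAxis = a • (p i : E3) + b • (p j : E3)} := by
    rintro h ⟨i, j, -, a, b, -, -, e⟩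
    simp only [Set.mem_iUnion]
    exact ⟨i, j, a, b, e⟩
  refine Set.Finite.subset (Set.finite_iUnion fun i => Set.finite_iUnion fun j =>
    Set.Subsingleton.finite ?_) this
  rintro h ⟨a, b, e⟩ h' ⟨a', b', e'⟩
  -- Two crossings with the same pair of vertices would put a multiple of the axis in their span,
  -- which genericity forbids unless it is zero.
  have d : (h - h') • zAxis = (a - a') • (p i : E3) + (b - b') • (p j : E3) := by
    have : (h - h') • zAxis = (w + h • zAxis) - (w + h' • zAxis) := by module
    rw [this, e, e']; module
  have h0 := congrArg (fun v : E3 => v 0) d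
  have h1 := congrArg (fun v : E3 => v 1) d
  simp only [PiLp.add_apply, PiLp.smul_apply, smul_eq_mul, zAxis_zero, zAxis_one, mul_zero] at h0 h1
  have := d.trans (hp.comb_eq_zero hn h0.symm h1.symm fun i => (p i : E3))
  have := congrArg (fun v : E3 => v 2) this
  simp at this
  linarith

/-- The vertices are moved vertically, and the non-polar faces stay positively oriented. -/
structure IsPositiveShift (G : SimpleGraph (Fin n)) (p : Fin n → S2) (Q : Fin n → E3) : Prop where
  zero : ∀ i, Q i 0 = (p i : E3) 0
  one : ∀ i, Q i 1 = (p i : E3) 1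
  det3_pos : ∀ i j k, IsNonPolarFace G p i j k → 0 < det3 (Q i) (Q j) (Q k)

lemma IsPositiveShift.cross_eq (hQ : IsPositiveShift G p Q) (i j : Fin n) :
    cross (Q i) (Q j) = cross (p i : E3) (p j) := by
  simp [cross, hQ.zero, hQ.one]

lemma IsPositiveShift.ne_zero (hn : 4 ≤ n) (hp : IsGenericTriangulation G p)
    (hQ : IsPositiveShift G p Q) (i : Fin n) : Q i ≠ 0 := by
  intro h
  have h0 := hQ.zero i
  have h1 := hQ.one i
  rw [h] at h0 h1
  rcases hp.horizontal_ne_zero hn i with h | h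
  · exact h h0.symm
  · exact h h1.symm

lemma Lifts.horizontal (hQ : IsPositiveShift G p Q) {w v : E3} (h : Lifts G p Q w v) :
    v 0 = w 0 ∧ v 1 = w 1 := by
  obtain ⟨i, j, -, a, b, -, -, rfl, rfl⟩ := h
  simp [hQ.zero, hQ.one]

lemma eq_add_zAxis {u v : E3} (h0 : u 0 = v 0) (h1 : u 1 = v 1) :
    u = v + (u 2 - v 2) • zAxis := by
  apply ext3 <;> simp [h0, h1]

/-- Between two consecutive points of the drawing on a vertical line there is a non-polar face. -/
lemma IsGenericTriangulation.exists_face_between (hp : IsGenericTriangulation G p)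
    (hpoles : ∀ i j k, ¬ (IsNorthFace G p i j k ∧ IsSouthFace G p i j k)) {w : E3} {s : ℝ}
    (hs : 0 < s) (h1 : w ∈ coneDrawing G (fun i => (p i : E3)))
    (h2 : w + s • zAxis ∈ coneDrawing G (fun i => (p i : E3)))
    (h : ∀ t, 0 < t → t < s → w + t • zAxis ∉ coneDrawing G (fun i => (p i : E3))) :
    ∃ i j k, IsNonPolarFace G p i j k ∧
      ∀ t, 0 < t → t < s → w + t • zAxis ∈ ccwCone (p i : E3) (p j) (p k) := by
  have zero_mem : (0 : E3) ∈ coneDrawing G (fun i => (p i : E3)) := by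
    simpa using smul_mem_coneDrawing h1 le_rfl
  have hK : IsPreconnected ((fun t : ℝ => w + t • zAxis) '' Set.Ioo 0 s) :=
    isPreconnected_Ioo.image _ (by fun_prop)
  obtain ⟨i, j, k, hf, hsub⟩ := hp.exists_face hK ⟨_, s / 2, ⟨by linarith, by linarith⟩, rfl⟩ (by
    rintro _ ⟨t, ht, rfl⟩
    refine ⟨fun h0 => h t ht.1 ht.2 ?_, h t ht.1 ht.2⟩
    have h0 : w + t • zAxis = 0 := h0
    rw [h0]; exact zero_mem)
  have hsub' : ∀ t, 0 < t → t < s → w + t • zAxis ∈ ccwCone (p i : E3) (p j) (p k) :=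
    fun t h1 h2 => hsub ⟨t, ⟨h1, h2⟩, rfl⟩
  have hmid := hsub' (s / 2) (by linarith) (by linarith)
  refine ⟨i, j, k, ⟨hf, fun hN => ?_, fun hS => ?_⟩, hsub'⟩
  -- A polar region is closed under motion towards its pole, so it would contain the endpoint of the
  -- segment on that side, a point of the drawing.
  · have hS : ¬ IsPolarFace (-1) G p i j k := fun hS => hpoles i j k ⟨hN, isSouthFace_iff.2 hS⟩
    have hW := IsPolarFace.winds hp one_ne_zero (isNorthFace_iff.1 hN) hS
    have := hW.add_mem hmid (h := s / 2) (by linarith)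
    refine hf.notMem_coneDrawing this ?_
    convert h2 using 1
    rw [add_assoc, ← add_smul]; congr 2; ring
  · have hN : ¬ IsPolarFace (- -1) G p i j k := fun hN =>
      hpoles i j k ⟨isNorthFace_iff.2 (by simpa using hN), hS⟩
    have hW := IsPolarFace.winds hp (by norm_num) (isSouthFace_iff.1 hS) hN
    have := hW.add_mem hmid (h := s / 2) (by linarith)
    refine hf.notMem_coneDrawing this ?_
    convert h1 using 1
    rw [add_assoc, ← add_smul]; convert add_zero w using 2
    rw [show s / 2 + s / 2 * -1 = 0 by ring, zero_smul]

lemma nonneg_of_forall_pos {a b s : ℝ} (hs : 0 < s) (h : ∀ t, 0 < t → t < s → 0 < a + t * b) :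
    0 ≤ a ∧ 0 ≤ a + s * b := by
  have hc : Continuous fun t : ℝ => a + t * b := by fun_prop
  have hcl : IsClosed {t : ℝ | 0 ≤ a + t * b} := isClosed_le continuous_const hc
  have hsub : Set.Icc 0 s ⊆ {t : ℝ | 0 ≤ a + t * b} := by
    rw [← closure_Ioo hs.ne]
    exact closure_minimal (fun t ht => (h t ht.1 ht.2).le) hcl
  refine ⟨?_, hsub ⟨hs.le, le_rfl⟩⟩
  simpa using hsub ⟨le_rfl, hs.le⟩

/-- Linear maps that fix the horizontal parts and preserve the orientation of a triangle preserve
the vertical order. -/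
lemma shift_pos {u v w u' v' w' : E3} (hc : cross u v ≠ 0) (hc' : cross u' v' = cross u v)
    (hD : 0 < det3 u v w) (hD' : 0 < det3 u' v' w') {a b c h h' : ℝ}
    (e : a • u + b • v + c • w = h • zAxis) (e' : a • u' + b • v' + c • w' = h' • zAxis) :
    0 < h ↔ 0 < h' := by
  -- Taking the determinant with `u` and `v` isolates `c`; hence `h` and `h'` are proportional to
  -- the two positive determinants.
  have k1 : c * det3 u v w = h * cross u v := by
    rw [← det3_comb_trd u v w a b c, e]; simp [det3_eq, cross]; ring
  have k2 : c * det3 u' v' w' = h' * cross u v := by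
    rw [← det3_comb_trd u' v' w' a b c, e', ← hc']; simp [det3_eq, cross]; ring
  have e : h * det3 u' v' w' = h' * det3 u v w := by
    apply mul_right_cancel₀ hc
    linear_combination det3 u v w * k2 - det3 u' v' w' * k1
  constructor <;> intro hh
  · have := mul_pos hh hD'
    rw [e] at this
    exact pos_of_mul_pos_left this hD.le
  · have := mul_pos hh hD
    rw [← e] at this
    exact pos_of_mul_pos_left this hD'.le

/-- The lifts of two consecutive points of the drawing on a vertical line are in the right order,
and the vertical segment between them is in the image of a face. -/
lemma IsPositiveShift.between (hn : 4 ≤ n) (hp : IsGenericTriangulation G p)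
    (hpoles : ∀ i j k, ¬ (IsNorthFace G p i j k ∧ IsSouthFace G p i j k))
    (hQ : IsPositiveShift G p Q) {w v v' : E3} {s : ℝ} (hs : 0 < s) (hv : Lifts G p Q w v)
    (hv' : Lifts G p Q (w + s • zAxis) v')
    (h : ∀ t, 0 < t → t < s → w + t • zAxis ∉ coneDrawing G (fun i => (p i : E3))) :
    v 2 < v' 2 ∧ ∃ i j k, IsFace G p i j k ∧ ∀ x : E3, x 0 = w 0 → x 1 = w 1 → v 2 < x 2 →
      x 2 < v' 2 → x ∈ ccwCone (Q i) (Q j) (Q k) := by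
  obtain ⟨i, j, k, hf, hin⟩ := hp.exists_face_between hpoles hs hv.mem hv'.mem h
  have hD := hf.det3_pos hp
  have hD' := hQ.det3_pos i j k hf
  have hf := hf.1
  have hc := hp.cross_ne_zero hf.1.ne
  have hc' := hQ.cross_eq i j
  set A : E3 := (p i : E3) with hA
  set B : E3 := (p j : E3) with hB
  set C : E3 := (p k : E3) with hC
  set D := det3 A B C with hDdef
  have e : ∀ t : ℝ, w + t • zAxis =
      (det3 w B C / D + t * (cross B C / D)) • A + (det3 A w C / D + t * (cross C A / D)) • B
        + (det3 A B w / D + t * (cross A B / D)) • C := by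
    intro t
    have := eq_comb_of_det3_ne_zero hD.ne' (w + t • zAxis)
    rw [det3_add_zAxis_fst, det3_add_zAxis_snd, det3_add_zAxis_trd, ← hDdef] at this
    simpa only [add_div, mul_div_assoc] using this
  have hpos : ∀ t, 0 < t → t < s → 0 < det3 w B C / D + t * (cross B C / D) ∧
      0 < det3 A w C / D + t * (cross C A / D) ∧ 0 < det3 A B w / D + t * (cross A B / D) := by
    intro t h1 h2
    rcases hin t h1 h2 with ⟨-, k1, k2, k3⟩ | ⟨h', -⟩
    · rw [det3_add_zAxis_fst] at k1
      rw [det3_add_zAxis_snd] at k2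
      rw [det3_add_zAxis_trd] at k3
      simp only [← mul_div_assoc, ← add_div]
      exact ⟨div_pos k1 hD, div_pos k2 hD, div_pos k3 hD⟩
    · exact absurd h' hD.not_gt
  generalize det3 w B C / D = α at e hpos
  generalize det3 A w C / D = β at e hpos
  generalize det3 A B w / D = γ at e hpos
  generalize cross B C / D = α' at e hpos
  generalize cross C A / D = β' at e hpos
  generalize cross A B / D = γ' at e hpos
  obtain ⟨α0, αs⟩ := nonneg_of_forall_pos hs fun t h1 h2 => (hpos t h1 h2).1
  obtain ⟨β0, βs⟩ := nonneg_of_forall_pos hs fun t h1 h2 => (hpos t h1 h2).2.1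
  obtain ⟨γ0, γs⟩ := nonneg_of_forall_pos hs fun t h1 h2 => (hpos t h1 h2).2.2
  -- The open face avoids the drawing, so at a point of the drawing one coordinate vanishes and the
  -- lift is computed on a side of the face.
  have boundary : ∀ t, w + t • zAxis ∈ coneDrawing G (fun i => (p i : E3)) →
      0 ≤ α + t * α' → 0 ≤ β + t * β' → 0 ≤ γ + t * γ' →
      Lifts G p Q (w + t • zAxis)
        ((α + t * α') • Q i + (β + t * β') • Q j + (γ + t * γ') • Q k) := by
    intro t ht ha hb hc
    have hnot := mt hf.notMem_coneDrawing (not_not.2 ht)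
    rw [e t]
    refine lifts_boundary hf.1 hf.2.1 hf.2.2.1 ha hb hc ?_
    by_contra! h0
    apply hnot
    rw [e t]
    refine Or.inl ⟨hD, ?_⟩
    rw [det3_comb_fst, det3_comb_snd, det3_comb_trd]
    exact ⟨mul_pos (lt_of_le_of_ne ha h0.1.symm) hD, mul_pos (lt_of_le_of_ne hb h0.2.1.symm) hD,
      mul_pos (lt_of_le_of_ne hc h0.2.2.symm) hD⟩
  have hv0 := boundary 0 (by simpa using hv.mem) (by simpa using α0) (by simpa using β0)
    (by simpa using γ0)
  have hvs := boundary s hv'.mem αs βs γs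
  have ev : v = α • Q i + β • Q j + γ • Q k :=
    hv.unique hn hp (by simpa using hv0)
  have ev' := hv'.unique hn hp hvs
  have hh := hv.horizontal hQ
  have hh' := hv'.horizontal hQ
  simp only [PiLp.add_apply, PiLp.smul_apply, smul_eq_mul, zAxis_zero, zAxis_one, mul_zero,
    add_zero] at hh'
  have hlt : v 2 < v' 2 := by
    rw [← sub_pos]
    -- The same coefficients express the vertical step before and after the shift, as `shift_pos`
    -- requires.
    have e1 : (s * α') • A + (s * β') • B + (s * γ') • C = s • zAxis := by
      have h1 := e s
      have h0 := e 0
      simp only [zero_mul, add_zero, zero_smul] at h0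
      calc _ = ((α + s * α') • A + (β + s * β') • B + (γ + s * γ') • C)
            - (α • A + β • B + γ • C) := by module
        _ = _ := by rw [← h1, ← h0]; module
    have e2 : (s * α') • Q i + (s * β') • Q j + (s * γ') • Q k = (v' 2 - v 2) • zAxis := by
      have h1 := eq_add_zAxis (u := v') (v := v) (by rw [hh.1, hh'.1]) (by rw [hh.2, hh'.2])
      calc _ = v' - v := by rw [ev, ev']; module
        _ = _ := by nth_rw 1 [h1]; module
    exact (shift_pos hc hc' hD hD' e1 e2).1 hs
  refine ⟨hlt, i, j, k, hf, fun x x0 x1 h1 h2 => ?_⟩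
  set t := (x 2 - v 2) / (v' 2 - v 2) with ht
  have hd : 0 < v' 2 - v 2 := sub_pos.2 hlt
  have t0 : 0 < t := div_pos (sub_pos.2 h1) hd
  have t1 : t < 1 := (div_lt_one hd).2 (by linarith)
  -- The segment between the lifts has the coordinates of the original segment, at proportional
  -- parameters.
  have ex : x = (α + t * s * α') • Q i + (β + t * s * β') • Q j + (γ + t * s * γ') • Q k := by
    have : x = v + t • (v' - v) := by
      apply ext3
      · simp [x0, hh.1, hh'.1]
      · simp [x1, hh.2, hh'.2]
      · simp [ht]; field_simp; ring
    rw [this, ev, ev']; module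
  obtain ⟨k1, k2, k3⟩ := hpos (t * s) (mul_pos t0 hs) (by nlinarith)
  rw [ex]
  refine Or.inl ⟨hD', ?_⟩
  rw [det3_comb_fst, det3_comb_snd, det3_comb_trd]
  exact ⟨mul_pos k1 hD', mul_pos k2 hD', mul_pos k3 hD'⟩

/-- Vertical shifts that preserve the orientations of the non-polar faces preserve the vertical
order of the points of the drawing. -/
lemma IsPositiveShift.mono (hn : 4 ≤ n) (hp : IsGenericTriangulation G p)
    (hpoles : ∀ i j k, ¬ (IsNorthFace G p i j k ∧ IsSouthFace G p i j k))
    (hQ : IsPositiveShift G p Q) {w v v' : E3} {s : ℝ} (hs : 0 < s) (hv : Lifts G p Q w v)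
    (hv' : Lifts G p Q (w + s • zAxis) v') : v 2 < v' 2 := by
  refine chain_induction (hp.finite_line hn w) (R := fun a b => ∀ v v',
    Lifts G p Q (w + a • zAxis) v → Lifts G p Q (w + b • zAxis) v' → v 2 < v' 2) ?_ ?_
    (a := 0) (b := s) (by simpa using hv.mem) hv'.mem hs v v' (by simpa using hv) hv'
  · intro a b ha hb hab h v v' hv hv'
    refine (hQ.between hn hp hpoles (sub_pos.2 hab) hv (v' := v') ?_ ?_).1
    · convert hv' using 1; module
    · intro t h1 h2 h3
      refine h (a + t) (by linarith) (by linarith) ?_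
      change w + (a + t) • zAxis ∈ coneDrawing G _
      convert h3 using 1; module
  · intro a b c ha hb hc hab hbc h1 h2 v v'' hv hv''
    obtain ⟨v', hv'⟩ := exists_lifts hb Q
    exact (h1 v v' hv hv').trans (h2 v' v'' hv' hv'')

/-- A point between two lifts on a vertical line is a lift or lies in the image of a face. -/
lemma IsPositiveShift.exists_face_between (hn : 4 ≤ n) (hp : IsGenericTriangulation G p)
    (hpoles : ∀ i j k, ¬ (IsNorthFace G p i j k ∧ IsSouthFace G p i j k))
    (hQ : IsPositiveShift G p Q) {w v v' x : E3} {s : ℝ} (hs : 0 < s) (hv : Lifts G p Q w v)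
    (hv' : Lifts G p Q (w + s • zAxis) v') (hx : x ∉ coneDrawing G Q) (x0 : x 0 = w 0)
    (x1 : x 1 = w 1) (h1 : v 2 < x 2) (h2 : x 2 < v' 2) :
    ∃ i j k, IsFace G p i j k ∧ x ∈ ccwCone (Q i) (Q j) (Q k) := by
  refine chain_induction (hp.finite_line hn w) (R := fun a b => ∀ v v',
    Lifts G p Q (w + a • zAxis) v → Lifts G p Q (w + b • zAxis) v' → v 2 < x 2 → x 2 < v' 2 →
    ∃ i j k, IsFace G p i j k ∧ x ∈ ccwCone (Q i) (Q j) (Q k)) ?_ ?_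
    (a := 0) (b := s) (by simpa using hv.mem) hv'.mem hs v v' (by simpa using hv) hv' h1 h2
  · intro a b ha hb hab h v v' hv hv' h1 h2
    obtain ⟨-, i, j, k, hf, H⟩ :=
      hQ.between hn hp hpoles (sub_pos.2 hab) hv (v' := v') (by convert hv' using 1; module) (by
        intro t h1 h2 h3
        refine h (a + t) (by linarith) (by linarith) ?_
        change w + (a + t) • zAxis ∈ coneDrawing G _
        convert h3 using 1; module)
    exact ⟨i, j, k, hf, H x (by simpa using x0) (by simpa using x1) h1 h2⟩
  · intro a b c ha hb hc hab hbc H1 H2 v v'' hv hv'' h1 h2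
    obtain ⟨v', hv'⟩ := exists_lifts hb Q
    rcases lt_trichotomy (x 2) (v' 2) with h | h | h
    · exact H1 v v' hv hv' h1 h
    · refine absurd hv'.mem_right ?_
      have hh := hv'.horizontal hQ
      rwa [← ext3 (u := x) (v := v') (by simp [hh.1, x0]) (by simp [hh.2, x1]) h]
    · exact H2 v' v'' hv' hv'' h h2

/-- The vertical order of two points of the drawing on a vertical line and of their lifts. -/
lemma IsPositiveShift.lt_iff (hn : 4 ≤ n) (hp : IsGenericTriangulation G p)
    (hpoles : ∀ i j k, ¬ (IsNorthFace G p i j k ∧ IsSouthFace G p i j k))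
    (hQ : IsPositiveShift G p Q) {w w' v v' : E3} (hv : Lifts G p Q w v)
    (hv' : Lifts G p Q w' v') (h0 : w 0 = w' 0) (h1 : w 1 = w' 1) :
    v 2 < v' 2 ↔ w 2 < w' 2 := by
  have key : ∀ {w w' v v' : E3}, Lifts G p Q w v → Lifts G p Q w' v' → w 0 = w' 0 → w 1 = w' 1 →
      w 2 < w' 2 → v 2 < v' 2 := by
    intro w w' v v' hv hv' h0 h1 h
    refine hQ.mono hn hp hpoles (sub_pos.2 h) hv ?_
    rwa [← eq_add_zAxis h0.symm h1.symm]
  refine ⟨fun h => ?_, key hv hv' h0 h1⟩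
  rcases lt_trichotomy (w 2) (w' 2) with h' | h' | h'
  · exact h'
  · obtain rfl := ext3 h0 h1 h'
    rw [hv.unique hn hp hv'] at h
    exact absurd h (lt_irrefl _)
  · exact absurd h (key hv' hv h0.symm h1.symm h').not_gt

lemma IsPositiveShift.injective (hn : 4 ≤ n) (hp : IsGenericTriangulation G p)
    (hpoles : ∀ i j k, ¬ (IsNorthFace G p i j k ∧ IsSouthFace G p i j k))
    (hQ : IsPositiveShift G p Q) {w w' v : E3} (hv : Lifts G p Q w v)
    (hv' : Lifts G p Q w' v) : w = w' := by
  have hh := hv.horizontal hQ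
  have hh' := hv'.horizontal hQ
  have h0 : w 0 = w' 0 := by rw [← hh.1, hh'.1]
  have h1 : w 1 = w' 1 := by rw [← hh.2, hh'.2]
  have k1 := mt (hQ.lt_iff hn hp hpoles hv hv' h0 h1).2 (lt_irrefl _)
  have k2 := mt (hQ.lt_iff hn hp hpoles hv' hv h0.symm h1.symm).2 (lt_irrefl _)
  exact ext3 h0 h1 (le_antisymm (not_lt.1 k2) (not_lt.1 k1))

end Triangulation


/-! ### A positive shift in general position is again a generic triangulation. -/

section Triangulation

variable {n : ℕ} {G : SimpleGraph (Fin n)} {p : Fin n → S2} {Q : Fin n → E3}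

lemma exists_smul_eq_of_toSphere_eq {u v : E3} (hu : u ≠ 0) (hv : v ≠ 0)
    (h : toSphere u = toSphere v) : ∃ r : ℝ, u = r • v := by
  have := congrArg (fun s : S2 => (s : E3)) h
  simp only [coe_toSphere hu, coe_toSphere hv] at this
  refine ⟨‖u‖ * ‖v‖⁻¹, ?_⟩
  rw [mul_smul, ← this, smul_smul, mul_inv_cancel₀ (norm_ne_zero_iff.2 hu), one_smul]

lemma cross_smul_self (u : E3) (r : ℝ) : cross u (r • u) = 0 := by
  simp [cross]; ring

lemma cross_smul_self' (u : E3) (r : ℝ) : cross (r • u) u = 0 := by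
  simp [cross]; ring

lemma IsPositiveShift.cross_ne_zero (hp : IsGenericTriangulation G p)
    (hQ : IsPositiveShift G p Q) {i j : Fin n} (hij : i ≠ j) : cross (Q i) (Q j) ≠ 0 := by
  rw [hQ.cross_eq]
  exact hp.cross_ne_zero hij

/-- An intersection in the shifted drawing pulls back, by injectivity of the lift, to one in `p`.
Antipodal endpoints are excluded because `cross` does not vanish. -/
lemma IsPositiveShift.embedding (hn : 4 ≤ n) (hp : IsGenericTriangulation G p)
    (hpoles : ∀ i j k, ¬ (IsNorthFace G p i j k ∧ IsSouthFace G p i j k))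
    (hQ : IsPositiveShift G p Q) : IsShortestPathEmbedding G (fun i => toSphere (Q i)) := by
  have hQ0 := hQ.ne_zero hn hp
  refine ⟨fun i j h => ?_, fun i j hij => ?_, fun i j k hij h => ?_,
    fun i j k l hij hkl hne w h1 h2 => ?_⟩
  · by_contra hij
    obtain ⟨r, hr⟩ := exists_smul_eq_of_toSphere_eq (hQ0 i) (hQ0 j) h
    apply hQ.cross_ne_zero hp hij
    rw [hr, cross_smul_self']
  · refine lt_of_le_of_ne (InnerProductGeometry.angle_le_pi _ _) fun h => ?_
    rw [coe_toSphere (hQ0 i), coe_toSphere (hQ0 j), InnerProductGeometry.angle_smul_left_of_pos _ _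
      (inv_pos.2 (norm_pos_iff.2 (hQ0 i))), InnerProductGeometry.angle_smul_right_of_pos _ _
      (inv_pos.2 (norm_pos_iff.2 (hQ0 j))), InnerProductGeometry.angle_eq_pi_iff] at h
    obtain ⟨-, r, -, hr⟩ := h
    apply hQ.cross_ne_zero hp hij.ne
    rw [hr, cross_smul_self]
  · obtain ⟨a, b, ha, hb, e⟩ := (mem_arc_toSphere (hQ0 i) (hQ0 j)).1 h
    have h1 := lifts_edge (p := p) (Q := Q) hij ha hb
    rw [← e, coe_toSphere (hQ0 k)] at h1
    have hpos : 0 < ‖Q k‖⁻¹ := inv_pos.2 (norm_pos_iff.2 (hQ0 k))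
    have h2 := lifts_vertex (G := G) (p := p) (Q := Q) k hpos.le
    have e := hQ.injective hn hp hpoles h2 h1
    apply hp.embedding.vertex_edge i j k hij
    rw [← toSphere_smul_coe (p k) hpos]
    exact mem_arc_of_eq_smul ha hb (smul_ne_zero hpos.ne' (p k).ne_zero) e
  · obtain ⟨a, b, ha, hb, e⟩ := (mem_arc_toSphere (hQ0 i) (hQ0 j)).1 h1
    obtain ⟨c, d, hc, hd, e'⟩ := (mem_arc_toSphere (hQ0 k) (hQ0 l)).1 h2
    have k1 := lifts_edge (p := p) (Q := Q) hij ha hb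
    have k2 := lifts_edge (p := p) (Q := Q) hkl hc hd
    rw [← e] at k1
    rw [← e'] at k2
    have e'' := hQ.injective hn hp hpoles k1 k2
    set u := a • (p i : E3) + b • (p j : E3) with hu
    have hu0 : u ≠ 0 := by
      intro h
      have := hp.comb_congr hn (i := i) (j := j) (a := a) (b := b) (c := 0) (d := 0)
        (by rw [← hu, h]; simp) Q
      rw [← e] at this
      exact w.ne_zero (by simpa using this)
    obtain ⟨m, hm, hm', em⟩ := hp.embedding.edge_edge i j k l hij hkl hne (toSphere u)
      (mem_arc_of_eq_smul ha hb hu0 hu) (mem_arc_of_eq_smul hc hd hu0 e'')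
    refine ⟨m, hm, hm', ?_⟩
    have hpos := norm_pos_iff.2 hu0
    have em : u = ‖u‖ • (p m : E3) := by
      rw [← em, coe_toSphere hu0, smul_smul, mul_inv_cancel₀ hpos.ne', one_smul]
    have hw : (w : E3) = ‖u‖ • Q m := by
      rw [e]; exact hp.comb_congr_vertex hn hm (hu.symm.trans em) Q
    have hw' : (w : E3) = (‖u‖ * ‖Q m‖) • (toSphere (Q m) : E3) := by
      rw [hw, coe_toSphere (hQ0 m), smul_smul, mul_assoc,
        mul_inv_cancel₀ (norm_ne_zero_iff.2 (hQ0 m)), mul_one]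
    rw [← toSphere_coe w, hw', toSphere_smul_coe _ (mul_pos hpos (norm_pos_iff.2 (hQ0 m)))]

/-- On every vertical line, a side of a polar face is the boundary between the polar region and its
complement, before and after the shift. -/
lemma IsPositiveShift.exists_side (hp : IsGenericTriangulation G p)
    (hQ : IsPositiveShift G p Q) {σ : ℝ} {i j k : Fin n} (hf : IsFace G p i j k)
    (hW : Winds σ (p i : E3) (p j) (p k)) (hD : det3 (Q i) (Q j) (Q k) ≠ 0) (s : E3) :
    ∃ (b vb : E3) (h : ℝ), Lifts G p Q b vb ∧ b = s + h • zAxis ∧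
      (∀ t : ℝ, b + (t * σ) • zAxis ∈ ccwCone (p i : E3) (p j) (p k) ↔ 0 < t) ∧
      (∀ t : ℝ, vb + (t * σ) • zAxis ∈ ccwCone (Q i) (Q j) (Q k) ↔ 0 < t) := by
  have hD0 := hf.det3_ne_zero hp
  have hWQ : Winds σ (Q i) (Q j) (Q k) := by
    simpa only [Winds, hQ.cross_eq] using hW
  obtain ⟨h, a, b, ha, hb, e | e | e⟩ := hW.exists_side hD0 s
  · exact ⟨_, _, h, lifts_edge hf.1 ha hb, e.symm, fun t => hW.side_add_mem_iff hD0 ha hb,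
      fun t => hWQ.side_add_mem_iff hD ha hb⟩
  · rw [ccwCone_rotate, ccwCone_rotate (Q i)]
    rw [det3_rotate] at hD hD0
    exact ⟨_, _, h, lifts_edge hf.2.1 ha hb, e.symm,
      fun t => hW.rotate.side_add_mem_iff hD0 ha hb, fun t => hWQ.rotate.side_add_mem_iff hD ha hb⟩
  · rw [← ccwCone_rotate, ← ccwCone_rotate (Q k)]
    rw [← det3_rotate] at hD hD0
    exact ⟨_, _, h, lifts_edge hf.2.2.1 ha hb, e.symm,
      fun t => hW.rotate.rotate.side_add_mem_iff hD0 ha hb,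
      fun t => hWQ.rotate.rotate.side_add_mem_iff hD ha hb⟩

/-- A vertical segment that leaves an open triangle crosses its boundary. -/
lemma exists_boundary_of_exit {a b c a' b' c' : ℝ} (ha : 0 < a) (hb : 0 < b) (hc : 0 < c)
    (h : ¬ (0 < a + a' ∧ 0 < b + b' ∧ 0 < c + c')) : ∃ t : ℝ, 0 < t ∧ t ≤ 1 ∧
      0 ≤ a + t * a' ∧ 0 ≤ b + t * b' ∧ 0 ≤ c + t * c' ∧
      (a + t * a' = 0 ∨ b + t * b' = 0 ∨ c + t * c' = 0) := by
  -- A zero of the smallest coordinate is a boundary point.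
  set f : ℝ → ℝ := fun t => min (a + t * a') (min (b + t * b') (c + t * c')) with hf
  have hcont : ContinuousOn f (Set.Icc 0 1) := by fun_prop
  have h0 : 0 < f 0 := by simp [hf, ha, hb, hc]
  have h1 : f 1 ≤ 0 := by
    by_contra hh
    apply h
    simpa [hf] using hh
  obtain ⟨t, ht, e⟩ := intermediate_value_Icc' zero_le_one hcont ⟨h1, h0.le⟩
  have e' : 0 ≤ f t := e.ge
  simp only [hf, le_min_iff] at e'
  refine ⟨t, lt_of_le_of_ne ht.1 ?_, ht.2, e'.1, e'.2.1, e'.2.2, ?_⟩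
  · rintro rfl
    exact h0.ne' e
  · by_contra! hh
    have : 0 < f t := lt_min (lt_of_le_of_ne e'.1 hh.1.symm)
      (lt_min (lt_of_le_of_ne e'.2.1 hh.2.1.symm) (lt_of_le_of_ne e'.2.2 hh.2.2.symm))
    exact this.ne' e

/-- Let `v` be the lift of `w`, and pull `v` back through the linear map of the face to a point `u`
inside the face, on the vertical line of `w`. The way from `u` to `w` leaves the face at a boundary
point `y`. The face map keeps the order of `u` and `y`, the lift keeps that of `y` and `w`, and `u`
and `w` have the same image `v`: a contradiction. -/
lemma IsPositiveShift.notMem_coneDrawing_of_nonPolar (hn : 4 ≤ n)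
    (hp : IsGenericTriangulation G p)
    (hpoles : ∀ i j k, ¬ (IsNorthFace G p i j k ∧ IsSouthFace G p i j k))
    (hQ : IsPositiveShift G p Q) {i j k : Fin n} (hf : IsNonPolarFace G p i j k) {v : E3}
    (hv : v ∈ ccwCone (Q i) (Q j) (Q k)) : v ∉ coneDrawing G Q := by
  intro hvD
  obtain ⟨w, hw⟩ := exists_lifts_of_mem (p := p) hvD
  have hD := hf.det3_pos hp
  have hD' := hQ.det3_pos i j k hf
  have hf := hf.1
  have hc := hp.cross_ne_zero hf.1.ne
  have hc' := hQ.cross_eq i j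
  have hh := hw.horizontal hQ
  set A : E3 := (p i : E3) with hA
  set B : E3 := (p j : E3) with hB
  set C : E3 := (p k : E3) with hC
  obtain ⟨a, b, c, ha, hb, hc0, ev⟩ : ∃ a b c : ℝ, 0 < a ∧ 0 < b ∧ 0 < c ∧
      v = a • Q i + b • Q j + c • Q k := by
    rcases hv with ⟨-, k1, k2, k3⟩ | ⟨h', -⟩
    · exact ⟨_, _, _, div_pos k1 hD', div_pos k2 hD', div_pos k3 hD',
        eq_comb_of_det3_ne_zero hD'.ne' v⟩
    · exact absurd h' hD'.not_gt
  set u := a • A + b • B + c • C with hu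
  have hu0 : u 0 = w 0 := by rw [← hh.1, ev, hu]; simp [hQ.zero, hA, hB, hC]
  have hu1 : u 1 = w 1 := by rw [← hh.2, ev, hu]; simp [hQ.one, hA, hB, hC]
  have ew := eq_comb_of_det3_ne_zero hD.ne' w
  set a' := det3 w B C / det3 A B C - a with ha'
  set b' := det3 A w C / det3 A B C - b with hb'
  set c' := det3 A B w / det3 A B C - c with hc''
  have ew : w = (a + a') • A + (b + b') • B + (c + c') • C := by
    rw [ha', hb', hc'']
    simpa using ew
  obtain ⟨t, t0, t1, k1, k2, k3, k0⟩ := exists_boundary_of_exit (a' := a') (b' := b') (c' := c')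
    ha hb hc0 (by
      rintro ⟨k1, k2, k3⟩
      refine hf.notMem_coneDrawing ?_ hw.mem
      rw [ew]
      refine Or.inl ⟨hD, ?_⟩
      rw [det3_comb_fst, det3_comb_snd, det3_comb_trd]
      exact ⟨mul_pos k1 hD, mul_pos k2 hD, mul_pos k3 hD⟩)
  have hy := lifts_boundary (p := p) (Q := Q) hf.1 hf.2.1 hf.2.2.1 k1 k2 k3 k0
  set y := (a + t * a') • A + (b + t * b') • B + (c + t * c') • C with hydef
  set vy := (a + t * a') • Q i + (b + t * b') • Q j + (c + t * c') • Q k with hvy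
  have ewu := eq_add_zAxis hu0.symm hu1.symm
  set s := w 2 - u 2 with hs
  have es : a' • A + b' • B + c' • C = s • zAxis := by
    calc _ = w - u := by rw [ew, hu]; module
      _ = _ := by nth_rw 1 [ewu]; module
  have ey : y = u + (t * s) • zAxis := by
    rw [mul_smul, ← es, hydef, hu]; module
  have hyh := hy.horizontal hQ
  have y0 : y 0 = w 0 := by rw [ey]; simpa using hu0
  have y1 : y 1 = w 1 := by rw [ey]; simpa using hu1
  have y2 : y 2 = u 2 + t * s := by rw [ey]; simp
  have evy := eq_add_zAxis (u := vy) (v := v) (by rw [hyh.1, hh.1, y0]) (by rw [hyh.2, hh.2, y1])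
  have e1 : (t * a') • A + (t * b') • B + (t * c') • C = (t * s) • zAxis := by
    rw [mul_smul t s, ← es]; module
  have e2 : (t * a') • Q i + (t * b') • Q j + (t * c') • Q k = (vy 2 - v 2) • zAxis := by
    calc _ = vy - v := by rw [hvy, ev]; module
      _ = _ := by nth_rw 1 [evy]; module
  have up := shift_pos hc hc' hD hD' e1 e2
  have down := shift_pos (a := -(t * a')) (b := -(t * b')) (c := -(t * c')) (h := -(t * s))
    (h' := -(vy 2 - v 2)) hc hc' hD hD'
    (by rw [neg_smul (t * s), ← e1]; module) (by rw [neg_smul (_ - _), ← e2]; module)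
  have o1 := hQ.lt_iff hn hp hpoles hw hy y0.symm y1.symm
  have o2 := hQ.lt_iff hn hp hpoles hy hw y0 y1
  rcases lt_trichotomy s 0 with hneg | hz | hpos
  · have := mul_pos_of_neg_of_neg hneg (neg_lt_zero.2 t0)
    have h1 := down.1 (by linarith)
    have := o2.1 (by linarith)
    nlinarith
  · rw [hz] at ewu
    rw [zero_smul, add_zero] at ewu
    refine hf.notMem_coneDrawing ?_ hw.mem
    rw [ewu]
    refine Or.inl ⟨hD, ?_⟩
    rw [hu, det3_comb_fst, det3_comb_snd, det3_comb_trd]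
    exact ⟨mul_pos ha hD, mul_pos hb hD, mul_pos hc0 hD⟩
  · have h1 := up.1 (by positivity)
    have := o1.1 (by linarith)
    nlinarith

/-- On a vertical line the polar region is, before and after the shift, the open ray beyond the same
boundary point, and the order relative to that point is preserved. -/
lemma IsPositiveShift.notMem_coneDrawing_of_polar (hn : 4 ≤ n)
    (hp : IsGenericTriangulation G p)
    (hpoles : ∀ i j k, ¬ (IsNorthFace G p i j k ∧ IsSouthFace G p i j k))
    (hQ : IsPositiveShift G p Q) {σ : ℝ} (hσ : σ = 1 ∨ σ = -1) {i j k : Fin n}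
    (hf : IsFace G p i j k) (hW : Winds σ (p i : E3) (p j) (p k))
    (hD : det3 (Q i) (Q j) (Q k) ≠ 0) {v : E3}
    (hv : v ∈ ccwCone (Q i) (Q j) (Q k)) : v ∉ coneDrawing G Q := by
  intro hvD
  obtain ⟨w, hw⟩ := exists_lifts_of_mem (p := p) hvD
  obtain ⟨b, vb, h, hb, eb, H, HQ⟩ := hQ.exists_side hp hf hW hD w
  have hh := hw.horizontal hQ
  have hhb := hb.horizontal hQ
  have b0 : b 0 = w 0 := by rw [eb]; simp
  have b1 : b 1 = w 1 := by rw [eb]; simp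
  have hσσ : σ * σ = 1 := by rcases hσ with rfl | rfl <;> norm_num
  have e : v = vb + (((v 2 - vb 2) * σ) * σ) • zAxis := by
    rw [mul_assoc, hσσ, mul_one]
    exact eq_add_zAxis (by rw [hh.1, hhb.1, b0]) (by rw [hh.2, hhb.2, b1])
  have e' : w = b + (((w 2 - b 2) * σ) * σ) • zAxis := by
    rw [mul_assoc, hσσ, mul_one]
    exact eq_add_zAxis b0.symm b1.symm
  rw [e, HQ] at hv
  have hnot := fun h => hf.notMem_coneDrawing h hw.mem
  rw [e', H] at hnot
  have o1 := hQ.lt_iff hn hp hpoles hw hb b0.symm b1.symm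
  have o2 := hQ.lt_iff hn hp hpoles hb hw b0 b1
  rcases hσ with rfl | rfl
  · have := o2.1 (by linarith)
    exact hnot (by linarith)
  · have := o1.1 (by linarith)
    exact hnot (by linarith)

lemma IsNorthFace.winds (hp : IsGenericTriangulation G p)
    (hpoles : ∀ i j k, ¬ (IsNorthFace G p i j k ∧ IsSouthFace G p i j k)) {i j k : Fin n}
    (h : IsNorthFace G p i j k) : Winds 1 (p i : E3) (p j) (p k) :=
  (isNorthFace_iff.1 h).winds hp one_ne_zero fun h' => hpoles i j k ⟨h, isSouthFace_iff.2 h'⟩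

lemma IsSouthFace.winds (hp : IsGenericTriangulation G p)
    (hpoles : ∀ i j k, ¬ (IsNorthFace G p i j k ∧ IsSouthFace G p i j k)) {i j k : Fin n}
    (h : IsSouthFace G p i j k) : Winds (-1) (p i : E3) (p j) (p k) :=
  (isSouthFace_iff.1 h).winds hp (by norm_num) fun h' =>
    hpoles i j k ⟨isNorthFace_iff.2 (by simpa using h'), h⟩

lemma IsGenericTriangulation.exists_northFace (hn : 4 ≤ n) (hp : IsGenericTriangulation G p) :
    ∃ i j k, IsNorthFace G p i j k := by
  obtain ⟨i, j, k, h⟩ := hp.exists_face_pole hn one_ne_zero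
  exact ⟨i, j, k, isNorthFace_iff.2 h⟩

lemma IsGenericTriangulation.exists_southFace (hn : 4 ≤ n) (hp : IsGenericTriangulation G p) :
    ∃ i j k, IsSouthFace G p i j k := by
  obtain ⟨i, j, k, h⟩ := hp.exists_face_pole hn (r := -1) (by norm_num)
  exact ⟨i, j, k, isSouthFace_iff.2 h⟩

/-- A face is non-polar, or it winds around the axis. -/
lemma IsFace.nonPolar_or_winds (hp : IsGenericTriangulation G p)
    (hpoles : ∀ i j k, ¬ (IsNorthFace G p i j k ∧ IsSouthFace G p i j k)) {i j k : Fin n} (hf : IsFace G p i j k) :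
    IsNonPolarFace G p i j k ∨ ∃ σ : ℝ, (σ = 1 ∨ σ = -1) ∧ Winds σ (p i : E3) (p j) (p k) := by
  by_cases hN : IsNorthFace G p i j k
  · exact Or.inr ⟨1, Or.inl rfl, hN.winds hp hpoles⟩
  by_cases hS : IsSouthFace G p i j k
  · exact Or.inr ⟨-1, Or.inr rfl, hS.winds hp hpoles⟩
  exact Or.inl ⟨hf, hN, hS⟩

lemma IsPositiveShift.notMem_coneDrawing (hn : 4 ≤ n)
    (hp : IsGenericTriangulation G p)
    (hpoles : ∀ i j k, ¬ (IsNorthFace G p i j k ∧ IsSouthFace G p i j k))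
    (hQ : IsPositiveShift G p Q) {i j k : Fin n}
    (hf : IsFace G p i j k) (hD : det3 (Q i) (Q j) (Q k) ≠ 0) {v : E3}
    (hv : v ∈ ccwCone (Q i) (Q j) (Q k)) : v ∉ coneDrawing G Q := by
  rcases hf.nonPolar_or_winds hp hpoles with h | ⟨σ, hσ, hW⟩
  · exact hQ.notMem_coneDrawing_of_nonPolar hn hp hpoles h hv
  · exact hQ.notMem_coneDrawing_of_polar hn hp hpoles hσ hf hW hD hv

/-- The images of the faces cover the complement of the image of the drawing. -/
lemma IsPositiveShift.exists_face (hn : 4 ≤ n) (hp : IsGenericTriangulation G p)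
    (hpoles : ∀ i j k, ¬ (IsNorthFace G p i j k ∧ IsSouthFace G p i j k))
    (hQ : IsPositiveShift G p Q)
    (hD : ∀ i j k, i ≠ j → j ≠ k → k ≠ i → det3 (Q i) (Q j) (Q k) ≠ 0) {x : E3}
    (hx : x ∉ coneDrawing G Q) :
    ∃ i j k, IsFace G p i j k ∧ x ∈ ccwCone (Q i) (Q j) (Q k) := by
  obtain ⟨i, j, k, hN⟩ := hp.exists_northFace hn
  obtain ⟨i', j', k', hS⟩ := hp.exists_southFace hn
  obtain ⟨b, vb, h, hb, eb, -, HN⟩ := hQ.exists_side hp hN.1 (hN.winds hp hpoles)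
    (hD _ _ _ hN.1.1.ne hN.1.2.1.ne hN.1.2.2.1.ne) x
  obtain ⟨c, vc, h', hc, ec, -, HS⟩ := hQ.exists_side hp hS.1 (hS.winds hp hpoles)
    (hD _ _ _ hS.1.1.ne hS.1.2.1.ne hS.1.2.2.1.ne) x
  have hhb := hb.horizontal hQ
  have hhc := hc.horizontal hQ
  have b0 : b 0 = x 0 := by rw [eb]; simp
  have b1 : b 1 = x 1 := by rw [eb]; simp
  have c0 : c 0 = x 0 := by rw [ec]; simp
  have c1 : c 1 = x 1 := by rw [ec]; simp
  have xb := eq_add_zAxis (u := x) (v := vb) (by rw [hhb.1, b0]) (by rw [hhb.2, b1])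
  have xc := eq_add_zAxis (u := x) (v := vc) (by rw [hhc.1, c0]) (by rw [hhc.2, c1])
  -- Above the side of the north face lies that face, below the side of the south face lies the
  -- other; the rest of the line is between two lifts.
  rcases lt_trichotomy (vb 2) (x 2) with hlt | heq | hgt
  · refine ⟨i, j, k, hN.1, ?_⟩
    rw [xb, ← mul_one (x 2 - vb 2), HN]
    linarith
  · rw [heq, sub_self, zero_smul, add_zero] at xb
    exact absurd (xb ▸ hb.mem_right) hx
  rcases lt_trichotomy (x 2) (vc 2) with hlt' | heq' | hgt'
  · refine ⟨i', j', k', hS.1, ?_⟩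
    rw [xc, show x 2 - vc 2 = (vc 2 - x 2) * (-1) by ring, HS]
    linarith
  · rw [heq', sub_self, zero_smul, add_zero] at xc
    exact absurd (xc ▸ hc.mem_right) hx
  · have hlt := (hQ.lt_iff hn hp hpoles hc hb (by rw [b0, c0]) (by rw [b1, c1])).1
      (by linarith)
    have e := eq_add_zAxis (u := b) (v := c) (by rw [b0, c0]) (by rw [b1, c1])
    exact hQ.exists_face_between hn hp hpoles (sub_pos.2 hlt) hc (e ▸ hb) hx c0.symm c1.symm
      hgt' hgt

lemma isPreconnected_ccwCone_of_pos {u v w : E3} (hD : 0 < det3 u v w) :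
    IsPreconnected (ccwCone u v w) := by
  refine Convex.isPreconnected ?_
  intro s hs t ht a b ha hb hab
  rcases hs with ⟨-, s1, s2, s3⟩ | ⟨h', -⟩
  swap
  · exact absurd h' hD.not_gt
  rcases ht with ⟨-, t1, t2, t3⟩ | ⟨h', -⟩
  swap
  · exact absurd h' hD.not_gt
  have key : ∀ {x y : ℝ}, 0 < x → 0 < y → 0 < a * x + b * y := by
    intro x y hx hy
    rcases ha.eq_or_lt with rfl | ha
    · have : b = 1 := by linarith
      simpa [this] using hy
    · have := mul_pos ha hx
      have := mul_nonneg hb hy.le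
      linarith
  refine Or.inl ⟨hD, ?_⟩
  rw [det3_add_smul_fst, det3_add_smul_snd, det3_add_smul_trd]
  exact ⟨key s1 t1, key s2 t2, key s3 t3⟩

/-- The cone need not be convex, but it is star-shaped about the pole it contains. -/
lemma isPreconnected_ccwCone_of_winds {σ : ℝ} {u v w : E3} (hW : Winds σ u v w)
    (hD : det3 u v w < 0) : IsPreconnected (ccwCone u v w) := by
  have hmem : σ • zAxis ∈ ccwCone u v w :=
    smul_zAxis_mem_ccwCone.2 (Or.inr ⟨hD, Or.inl hW.2.1⟩)
  refine (StarConvex.isPathConnected (a := σ • zAxis) ?_ hmem).isConnected.isPreconnected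
  intro s hs a b ha hb hab
  rcases ha.eq_or_lt with rfl | ha
  · have : b = 1 := by linarith
    simpa [this] using hs
  have pos : b • s + (a * σ) • zAxis ∈ ccwCone u v w := by
    rcases hb.eq_or_lt with rfl | hb
    · have : a = 1 := by linarith
      simpa [this] using hmem
    · refine hW.add_mem ?_ ha.le
      simpa using (ccwCone_smul_iff one_pos one_pos one_pos hb).2 hs
  rwa [add_comm, smul_smul]

lemma isPreconnected_ccwRegion {u v w : E3} (hu : u ≠ 0) (hv : v ≠ 0) (hw : w ≠ 0)
    (h : IsPreconnected (ccwCone u v w)) :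
    IsPreconnected (ccwRegion (toSphere u) (toSphere v) (toSphere w)) := by
  have : ccwRegion (toSphere u) (toSphere v) (toSphere w) = toSphere '' ccwCone u v w := by
    ext s
    constructor
    · intro hs
      exact ⟨s, (coe_mem_ccwCone hu hv hw).1 hs, toSphere_coe s⟩
    · rintro ⟨t, ht, rfl⟩
      exact (toSphere_mem_ccwRegion hu hv hw (ne_zero_of_mem_ccwCone ht)).2 ht
  rw [this]
  exact h.image _ (continuousOn_toSphere.mono fun s hs => ne_zero_of_mem_ccwCone hs)

/-- A positive vertical shift in general position is a generic triangulation. -/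
lemma IsPositiveShift.isGenericTriangulation (hn : 4 ≤ n) (hp : IsGenericTriangulation G p)
    (hpoles : ∀ i j k, ¬ (IsNorthFace G p i j k ∧ IsSouthFace G p i j k))
    (hQ : IsPositiveShift G p Q)
    (hD : ∀ i j k, i ≠ j → j ≠ k → k ≠ i → det3 (Q i) (Q j) (Q k) ≠ 0) :
    IsGenericTriangulation G (fun i => toSphere (Q i)) := by
  have hQ0 := hQ.ne_zero hn hp
  have inner_iff : ∀ (ν : E3) i, toSphere (Q i) ∈ greatCircle ν ↔ inner ℝ ν (Q i) = 0 := by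
    intro ν i
    simp only [greatCircle, Set.mem_ofPred_eq, coe_toSphere (hQ0 i), inner_smul_right]
    simp [hQ0 i]
  refine ⟨hQ.embedding hn hp hpoles, fun ν hν => ?_, fun ν hν hN hS => ?_, ?_⟩
  · by_contra! h
    obtain ⟨i, j, k, hi, hj, hk, hij, hik, hjk⟩ := (Set.two_lt_ncard_iff (Set.toFinite _)).1 h
    exact hD i j k hij hjk hik.symm (det3_eq_zero_iff.2
      ⟨ν, hν, (inner_iff ν i).1 hi, (inner_iff ν j).1 hj, (inner_iff ν k).1 hk⟩)
  · convert hp.generic_pole ν hν hN hS using 4 with i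
    rw [inner_iff]
    -- Great circles through the poles have horizontal normals, so they do not notice vertical
    -- shifts.
    have h2 : ν 2 = 0 := by
      simpa [greatCircle, coe_northPole, inner_eq] using hN
    simp [greatCircle, inner_eq, h2, hQ.zero, hQ.one]
  · rintro F ⟨x, hx, rfl⟩
    rw [mem_drawing_toSphere hQ0] at hx
    obtain ⟨i, j, k, hf, hin⟩ := hQ.exists_face hn hp hpoles hD hx
    have hDijk := hD i j k hf.1.ne hf.2.1.ne hf.2.2.1.ne
    refine ⟨i, j, k, hf.1, hf.2.1, hf.2.2.1, ?_⟩
    have hxR := (coe_mem_ccwCone (hQ0 i) (hQ0 j) (hQ0 k)).2 hin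
    have hsub : ccwRegion (toSphere (Q i)) (toSphere (Q j)) (toSphere (Q k)) ⊆
        (drawing G (fun i => toSphere (Q i)))ᶜ := by
      intro s hs
      rw [Set.mem_compl_iff, mem_drawing_toSphere hQ0]
      exact hQ.notMem_coneDrawing hn hp hpoles hf hDijk
        ((coe_mem_ccwCone (hQ0 i) (hQ0 j) (hQ0 k)).1 hs)
    have hconn : IsPreconnected (ccwCone (Q i) (Q j) (Q k)) := by
      rcases hDijk.lt_or_gt with hlt | hgt
      · rcases hf.nonPolar_or_winds hp hpoles with h | ⟨σ, -, hW⟩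
        · exact absurd hlt (hQ.det3_pos i j k h).not_gt
        · refine isPreconnected_ccwCone_of_winds (σ := σ) ?_ hlt
          simpa only [Winds, hQ.cross_eq] using hW
      · exact isPreconnected_ccwCone_of_pos hgt
    have hxc : x ∈ (drawing G (fun i => toSphere (Q i)))ᶜ := hsub hxR
    -- The region is open and connected, avoids the drawing, and has its frontier in the drawing; so
    -- it is a whole component.
    apply Set.Subset.antisymm
    · refine isPreconnected_connectedComponentIn.subset_of_closure_inter_subset
        (isOpen_ccwRegion _ _ _) ⟨x, mem_connectedComponentIn hxc, hxR⟩ ?_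
      rintro s ⟨hs, hs'⟩
      by_contra hsR
      have hs' := connectedComponentIn_subset _ _ hs'
      apply hs'
      rcases mem_arc_of_mem_closure_ccwRegion hs hsR with h | h | h
      · exact Or.inr ⟨i, j, hf.1, h⟩
      · exact Or.inr ⟨j, k, hf.2.1, h⟩
      · exact Or.inr ⟨k, i, hf.2.2.1, h⟩
    · exact (isPreconnected_ccwRegion (hQ0 i) (hQ0 j) (hQ0 k) hconn).subset_connectedComponentIn
        hxR hsub

end Triangulation


/-! ### Sinkable implies feasible. -/

lemma exists_polar (x y : ℝ) (h : x ≠ 0 ∨ y ≠ 0) :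
    ∃ r θ : ℝ, 0 < r ∧ x = r * Real.cos θ ∧ y = r * Real.sin θ := by
  refine ⟨‖(⟨x, y⟩ : ℂ)‖, Complex.arg ⟨x, y⟩, norm_pos_iff.2 fun h0 => ?_, ?_, ?_⟩
  · have h1 := congrArg Complex.re h0
    have h2 := congrArg Complex.im h0
    rcases h with h | h
    · exact h h1
    · exact h h2
  · rw [Complex.norm_mul_cos_arg]
  · rw [Complex.norm_mul_sin_arg]

lemma SameLongitude.exists_smul {u v : S2} (h : SameLongitude u v) :
    ∃ ρ : ℝ, 0 < ρ ∧ (v : E3) 0 = ρ * (u : E3) 0 ∧ (v : E3) 1 = ρ * (u : E3) 1 := by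
  obtain ⟨θ, ⟨r, hr, h0, h1⟩, s, hs, k0, k1⟩ := h
  refine ⟨s / r, div_pos hs hr, ?_, ?_⟩
  · rw [h0, k0]; field_simp
  · rw [h1, k1]; field_simp

lemma mem_arc_of_relation {u v w : S2} {a b c : ℝ}
    (h : a • (u : E3) + b • (v : E3) + c • (w : E3) = 0) (ha : 0 < a) (hb : b ≤ 0) (hc : c ≤ 0) :
    u ∈ arc v w := by
  refine ⟨-b / a, -c / a, div_nonneg (by linarith) ha.le, div_nonneg (by linarith) ha.le, ?_⟩
  have : a • (u : E3) = (-b) • (v : E3) + (-c) • (w : E3) := by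
    rw [← sub_eq_zero]; exact Eq.trans (by module) h
  rw [div_eq_inv_mul, div_eq_inv_mul, mul_smul, mul_smul, ← smul_add, ← this, smul_smul,
    inv_mul_cancel₀ ha.ne', one_smul]

/-- A linear relation between three points, none of which is on the arc between the other two, has
coefficients of the same sign. -/
lemma same_sign_of_relation {u v w : S2} {a b c : ℝ}
    (h : a • (u : E3) + b • (v : E3) + c • (w : E3) = 0) (ha : a ≠ 0) (hb : b ≠ 0) (hc : c ≠ 0)
    (hu : u ∉ arc v w) (hv : v ∉ arc w u) (hw : w ∉ arc u v) :
    (0 < a ∧ 0 < b ∧ 0 < c) ∨ (a < 0 ∧ b < 0 ∧ c < 0) := by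
  have h1 : b • (v : E3) + c • (w : E3) + a • (u : E3) = 0 := Eq.trans (by abel) h
  have h2 : c • (w : E3) + a • (u : E3) + b • (v : E3) = 0 := Eq.trans (by abel) h
  have neg : ∀ {u v w : S2} {a b c : ℝ}, a • (u : E3) + b • (v : E3) + c • (w : E3) = 0 →
      (-a) • (u : E3) + (-b) • (v : E3) + (-c) • (w : E3) = 0 := by
    intro u v w a b c h
    rw [← neg_eq_zero]; exact Eq.trans (by module) h
  rcases ha.lt_or_gt with ha | ha <;> rcases hb.lt_or_gt with hb | hb <;>
    rcases hc.lt_or_gt with hc | hc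
  · exact Or.inr ⟨ha, hb, hc⟩
  · exact absurd (mem_arc_of_relation h2 hc ha.le hb.le) hw
  · exact absurd (mem_arc_of_relation h1 hb hc.le ha.le) hv
  · exact absurd (mem_arc_of_relation (neg h) (by linarith) (by linarith) (by linarith)) hu
  · exact absurd (mem_arc_of_relation h ha hb.le hc.le) hu
  · exact absurd (mem_arc_of_relation (neg h1) (by linarith) (by linarith) (by linarith)) hv
  · exact absurd (mem_arc_of_relation (neg h2) (by linarith) (by linarith) (by linarith)) hw
  · exact Or.inl ⟨ha, hb, hc⟩

/-- A functional that takes the value `-1` at three points below the equator that wind around the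
axis is increasing along the axis. -/
lemma exists_functional {u v w : E3} (hW : Winds 1 u v w) (hu : u 2 < 0) (hv : v 2 < 0)
    (hw : w 2 < 0) : ∃ α β γ : ℝ, 0 < γ ∧ α * u 0 + β * u 1 + γ * u 2 = -1 ∧
      α * v 0 + β * v 1 + γ * v 2 = -1 ∧ α * w 0 + β * w 1 + γ * w 2 = -1 := by
  obtain ⟨h1, h2, h3⟩ := hW
  rw [one_mul] at h1 h2 h3
  have hD : det3 u v w < 0 := by
    have : det3 u v w = cross v w * u 2 + cross w u * v 2 + cross u v * w 2 := by
      simp only [det3_eq, cross]; ring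
    rw [this]
    have := mul_neg_of_pos_of_neg h2 hu
    have := mul_neg_of_pos_of_neg h3 hv
    have := mul_neg_of_pos_of_neg h1 hw
    linarith
  -- Cramer's rule for the system with right-hand sides `-1`.
  refine ⟨-(v 1 * w 2 - v 2 * w 1 + (w 1 * u 2 - w 2 * u 1) + (u 1 * v 2 - u 2 * v 1)) /
      det3 u v w,
    -(v 2 * w 0 - v 0 * w 2 + (w 2 * u 0 - w 0 * u 2) + (u 2 * v 0 - u 0 * v 2)) / det3 u v w,
    -(cross v w + cross w u + cross u v) / det3 u v w,
    div_pos_of_neg_of_neg (by linarith) hD, ?_, ?_, ?_⟩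
  all_goals
    rw [div_mul_eq_mul_div, div_mul_eq_mul_div, div_mul_eq_mul_div, ← add_div, ← add_div,
      div_eq_iff hD.ne]
    simp only [det3_eq, cross]
    ring

section Triangulation

variable {n : ℕ} {G : SimpleGraph (Fin n)} {p : Fin n → S2}

lemma IsNorthFace.rotate {i j k : Fin n} (h : IsNorthFace G p i j k) : IsNorthFace G p j k i := by
  rw [isNorthFace_iff] at h ⊢
  exact ⟨h.1.rotate, by rw [← ccwCone_rotate]; exact h.2⟩

/-- Push `u` into the region: towards `v + w` for a small triangle, away from `v` for a complement.
-/
lemma mem_closure_ccwRegion {u v w : S2} (hD : det3 (u : E3) v w ≠ 0) :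
    u ∈ closure (ccwRegion u v w) := by
  obtain ⟨d, hd⟩ : ∃ d : E3, ∀ ε : ℝ, 0 < ε → (u : E3) + ε • d ∈ ccwCone (u : E3) v w := by
    rcases hD.lt_or_gt with hD | hD
    · refine ⟨-(v : E3), fun ε hε => Or.inr ⟨hD, Or.inr (Or.inl ?_)⟩⟩
      have := det3_comb_snd (u : E3) v w 1 (-ε) 0
      rw [show (u : E3) + ε • -(v : E3) = (1 : ℝ) • (u : E3) + (-ε) • (v : E3) + (0 : ℝ) • (w : E3)
        by module, this]
      nlinarith
    · refine ⟨(v : E3) + (w : E3), fun ε hε => Or.inl ⟨hD, ?_⟩⟩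
      rw [show (u : E3) + ε • ((v : E3) + (w : E3)) =
        (1 : ℝ) • (u : E3) + ε • (v : E3) + ε • (w : E3) by module, det3_comb_fst, det3_comb_snd,
        det3_comb_trd]
      exact ⟨by linarith, mul_pos hε hD, mul_pos hε hD⟩
  have ht : Filter.Tendsto (fun ε : ℝ => toSphere ((u : E3) + ε • d)) (nhdsWithin 0 (Set.Ioi 0))
      (nhds u) := by
    have h1 : ContinuousAt toSphere (u : E3) :=
      continuousOn_toSphere.continuousAt (isOpen_compl_singleton.mem_nhds u.ne_zero)
    have h2 : Filter.Tendsto (fun ε : ℝ => (u : E3) + ε • d) (nhds 0) (nhds (u : E3)) := by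
      have : Continuous fun ε : ℝ => (u : E3) + ε • d := by fun_prop
      simpa using this.tendsto 0
    have h3 := h1.tendsto.comp h2
    rw [toSphere_coe] at h3
    exact h3.mono_left nhdsWithin_le_nhds
  refine mem_closure_of_tendsto ht ?_
  filter_upwards [self_mem_nhdsWithin] with ε hε
  have := hd ε hε
  exact (toSphere_mem_ccwRegion_coe (ne_zero_of_mem_ccwCone this)).2 this

/-- Both triples bound the component of the pole. A vertex of one lies in the closure of the region
but not in it, hence on a side, and an embedding allows only the endpoints there. -/
lemma IsNorthFace.vertex_eq (hp : IsGenericTriangulation G p) {i j k i' j' k' : Fin n}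
    (h : IsNorthFace G p i j k) (h' : IsNorthFace G p i' j' k') : i' = i ∨ i' = j ∨ i' = k := by
  have e : ccwRegion (p i) (p j) (p k) = ccwRegion (p i') (p j') (p k') := by
    obtain ⟨⟨-, -, -, x, hx, e⟩, hN⟩ := h
    obtain ⟨⟨-, -, -, x', hx', e'⟩, hN'⟩ := h'
    rw [e] at hN ⊢
    rw [e'] at hN' ⊢
    rw [connectedComponentIn_eq hN, connectedComponentIn_eq hN']
  have hcl := mem_closure_ccwRegion (h'.1.det3_ne_zero hp)
  rw [← e] at hcl
  have hnot : p i' ∉ ccwRegion (p i) (p j) (p k) := by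
    rw [mem_ccwRegion]
    intro hh
    refine h.1.notMem_coneDrawing hh ?_
    exact mem_drawing.1 (Or.inl ⟨i', rfl⟩)
  rcases mem_arc_of_mem_closure_ccwRegion hcl hnot with h0 | h0 | h0
  · have := hp.embedding.vertex_edge _ _ _ h.1.1 h0
    tauto
  · have := hp.embedding.vertex_edge _ _ _ h.1.2.1 h0
    tauto
  · have := hp.embedding.vertex_edge _ _ _ h.1.2.2.1 h0
    tauto

/-- In an embedding whose vertices are on the same longitudes, no non-polar face is degenerate. -/
lemma IsNonPolarFace.det3_ne_zero_of_longitude (hp : IsGenericTriangulation G p) {i j k : Fin n}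
    (hf : IsNonPolarFace G p i j k) {q : Fin n → S2} (hq : IsShortestPathEmbedding G q)
    (hl : ∀ i, SameLongitude (p i) (q i)) : det3 (q i : E3) (q j) (q k) ≠ 0 := by
  intro h0
  choose ρ hρ h0' h1' using fun i => (hl i).exists_smul
  have hcross : ∀ i j, cross (q i : E3) (q j) = ρ i * ρ j * cross (p i : E3) (p j) := by
    intro i j
    simp only [cross, h0', h1']; ring
  have hcne : ∀ {i j}, i ≠ j → cross (q i : E3) (q j) ≠ 0 := by
    intro i j hij
    rw [hcross]
    exact mul_ne_zero (mul_ne_zero (hρ i).ne' (hρ j).ne') (hp.cross_ne_zero hij)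
  have hrel := det3_smul_zAxis (q i : E3) (q j) (q k)
  rw [h0, zero_smul] at hrel
  have hD := hf.det3_pos hp
  obtain ⟨⟨hij, hjk, hki, hF⟩, hN, hS⟩ := hf
  have pos_of : ∀ {σ : ℝ} {i j}, 0 < σ * cross (q i : E3) (q j) →
      0 < σ * cross (p i : E3) (p j) := by
    intro σ i j h
    rw [hcross] at h
    have h' : 0 < (ρ i * ρ j) * (σ * cross (p i : E3) (p j)) := by linarith
    exact (mul_pos_iff_of_pos_left (mul_pos (hρ i) (hρ j))).1 h'
  have polar : ∀ σ : ℝ, 0 < σ * cross (q j : E3) (q k) → 0 < σ * cross (q k : E3) (q i) →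
      0 < σ * cross (q i : E3) (q j) → IsPolarFace σ G p i j k := fun σ h1 h2 h3 =>
    ⟨⟨hij, hjk, hki, hF⟩, smul_zAxis_mem_ccwCone.2 (Or.inl ⟨hD, pos_of h1, pos_of h2, pos_of h3⟩)⟩
  have hu : q i ∉ arc (q j) (q k) := fun h => by
    rcases hq.vertex_edge _ _ _ hjk h with h | h
    · exact hij.ne h
    · exact hki.ne h.symm
  have hv : q j ∉ arc (q k) (q i) := fun h => by
    rcases hq.vertex_edge _ _ _ hki h with h | h
    · exact hjk.ne h
    · exact hij.ne h.symm
  have hw : q k ∉ arc (q i) (q j) := fun h => by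
    rcases hq.vertex_edge _ _ _ hij h with h | h
    · exact hki.ne h
    · exact hjk.ne h.symm
  -- Equal signs mean that the triangle winds around the axis, in `p` as well; being positively
  -- oriented there, it would contain a pole.
  rcases same_sign_of_relation hrel.symm (hcne hjk.ne) (hcne hki.ne) (hcne hij.ne) hu hv hw
    with ⟨h1, h2, h3⟩ | ⟨h1, h2, h3⟩
  · exact hN (isNorthFace_iff.2 (polar 1 (by linarith) (by linarith) (by linarith)))
  · exact hS (isSouthFace_iff.2 (polar (-1) (by linarith) (by linarith) (by linarith)))

/-- The non-polar faces stay positively oriented during a longitudinal morph. -/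
lemma IsLongitudinalMorph.det3_pos (hp : IsGenericTriangulation G p) {q : Fin n → S2}
    {H : unitInterval → Fin n → S2} (hH : IsLongitudinalMorph G p q H) {i j k : Fin n}
    (hf : IsNonPolarFace G p i j k) : 0 < det3 (q i : E3) (q j) (q k) := by
  set f : unitInterval → ℝ := fun t => det3 (H t i : E3) (H t j) (H t k) with hfdef
  have hcont : Continuous f := by
    have c : ∀ i, Continuous fun t => (H t i : E3) := fun i =>
      continuous_subtype_val.comp (hH.continuous i)
    have ci := c i
    have cj := c j
    have ck := c k
    simp only [hfdef, det3_eq]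
    fun_prop
  have h0 : 0 < f 0 := by
    simp only [hfdef, hH.source]
    exact hf.det3_pos hp
  by_contra hle
  have h1 : f 1 ≤ 0 := by
    simp only [hfdef, hH.target]
    exact not_lt.1 hle
  obtain ⟨t, ht⟩ := mem_range_of_exists_le_of_exists_ge hcont ⟨1, h1⟩ ⟨0, h0.le⟩
  exact hf.det3_ne_zero_of_longitude hp (hH.embedding t) (hH.longitudinal t) ht

lemma vol'_apply (X : Fin n → E3) (i j k : Fin n) (z : Fin n → ℝ) : vol' X i j k z =
    X i 0 * X j 1 * z k - X i 0 * z j * X k 1 - X i 1 * X j 0 * z k + X i 1 * z j * X k 0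
      + z i * X j 0 * X k 1 - z i * X j 1 * X k 0 := by
  simp [vol', Matrix.det_fin_three]

lemma sinkLP_feasible_iff {X : Fin n → E3} : (sinkLP G p X).Feasible ↔ ∃ z : Fin n → ℝ,
    (∀ i j k, IsNorthFace G p i j k → z i = -1) ∧
      ∀ i j k, IsNonPolarFace G p i j k → 0 ≤ vol' X i j k z := by
  refine exists_congr fun z => and_congr ?_ ?_
  · constructor
    · intro h i j k hN
      exact h (LinearMap.proj i, -1) ⟨i, ⟨j, k, hN⟩, rfl⟩
    · rintro h _ ⟨i, ⟨j, k, hN⟩, rfl⟩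
      exact h i j k hN
  · constructor
    · intro h i j k hf
      exact h (vol' X i j k, 0) ⟨(i, j, k), hf, rfl⟩
    · rintro h _ ⟨⟨i, j, k⟩, hf, rfl⟩
      exact h i j k hf

lemma Sinkable.feasible (hn : 4 ≤ n) (hp : IsGenericTriangulation G p)
    (hpoles : ∀ i j k, ¬ (IsNorthFace G p i j k ∧ IsSouthFace G p i j k)) {X : Fin n → E3}
    (hX : IsHomogeneousCoordinates p X) (hs : Sinkable G p) : (sinkLP G p X).Feasible := by
  obtain ⟨q, -, hq, H, hH⟩ := hs
  choose r hr hXr using hX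
  have hl : ∀ i, SameLongitude (p i) (q i) := fun i => by
    have := hH.longitudinal 1 i
    rwa [hH.target] at this
  choose ρ hρ h0 h1 using fun i => (hl i).exists_smul
  -- The scaling that gives the final vertices the horizontal parts of `X`.
  set Q : Fin n → E3 := fun i => (r i / ρ i) • (q i : E3) with hQ
  have hpos : ∀ i, 0 < r i / ρ i := fun i => div_pos (hr i) (hρ i)
  have Q0 : ∀ i, Q i 0 = X i 0 := fun i => by
    have := (hρ i).ne'
    simp [hQ, hXr, h0]; field_simp
  have Q1 : ∀ i, Q i 1 = X i 1 := fun i => by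
    have := (hρ i).ne'
    simp [hQ, hXr, h1]; field_simp
  have Q2 : ∀ i, Q i 2 < 0 := fun i => by
    simpa [hQ] using mul_neg_of_pos_of_neg (hpos i) (hq i)
  obtain ⟨i, j, k, hN⟩ := hp.exists_northFace hn
  have hcross : ∀ i j, cross (Q i) (Q j) = r i * r j * cross (p i : E3) (p j) := by
    intro i j
    simp only [cross, Q0, Q1, hXr]
    simp; ring
  have hW : Winds 1 (Q i) (Q j) (Q k) := by
    have := hN.winds hp hpoles
    simp only [Winds, one_mul, hcross] at this ⊢
    exact ⟨mul_pos (mul_pos (hr _) (hr _)) this.1, mul_pos (mul_pos (hr _) (hr _)) this.2.1,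
      mul_pos (mul_pos (hr _) (hr _)) this.2.2⟩
  obtain ⟨α, β, γ, hγ, e1, e2, e3⟩ := exists_functional hW (Q2 i) (Q2 j) (Q2 k)
  refine sinkLP_feasible_iff.2 ⟨fun m => α * Q m 0 + β * Q m 1 + γ * Q m 2, ?_, ?_⟩
  · intro i' j' k' hN'
    rcases hN.vertex_eq hp hN' with rfl | rfl | rfl <;> assumption
  · intro a b c hf
    -- Multiples of the first two columns drop out of the determinant, leaving the factor `γ`.
    have : vol' X a b c (fun m => α * Q m 0 + β * Q m 1 + γ * Q m 2) =
        γ * det3 (Q a) (Q b) (Q c) := by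
      rw [vol'_apply, det3_eq]
      simp only [← Q0, ← Q1]
      ring
    rw [this]
    simp only [hQ, det3_smul_smul_smul]
    have := hH.det3_pos hp hf
    have := hpos a
    have := hpos b
    have := hpos c
    positivity

/-! ### Feasible implies sinkable. -/

lemma vol'_eq_mul_det3 {X Q : Fin n → E3} {r z : Fin n → ℝ}
    (h0 : ∀ i, X i 0 = r i * Q i 0) (h1 : ∀ i, X i 1 = r i * Q i 1)
    (h2 : ∀ i, z i = r i * Q i 2) (i j k : Fin n) :
    vol' X i j k z = r i * r j * r k * det3 (Q i) (Q j) (Q k) := by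
  rw [vol'_apply, det3_eq, h0, h0, h0, h1, h1, h1, h2, h2, h2]; ring

/-- The linear interpolation from `p` to the vectors with the same horizontal parts and vertical
parts `ζ`. -/
def verticalPath (p : Fin n → S2) (ζ : Fin n → ℝ) (t : ℝ) (i : Fin n) : E3 :=
  (p i : E3) + (t * (ζ i - (p i : E3) 2)) • zAxis

variable {ζ : Fin n → ℝ}

lemma verticalPath_zero_apply (t : ℝ) (i : Fin n) : verticalPath p ζ t i 0 = (p i : E3) 0 := by
  simp [verticalPath]

lemma verticalPath_one_apply (t : ℝ) (i : Fin n) : verticalPath p ζ t i 1 = (p i : E3) 1 := by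
  simp [verticalPath]

lemma verticalPath_two_apply (t : ℝ) (i : Fin n) :
    verticalPath p ζ t i 2 = (p i : E3) 2 + t * (ζ i - (p i : E3) 2) := by
  simp [verticalPath]

/-- Only the third column varies, and it is affine in `t`. -/
lemma det3_verticalPath (t : ℝ) (i j k : Fin n) :
    det3 (verticalPath p ζ t i) (verticalPath p ζ t j) (verticalPath p ζ t k) =
      (1 - t) * det3 (p i : E3) (p j) (p k) +
        t * det3 (verticalPath p ζ 1 i) (verticalPath p ζ 1 j) (verticalPath p ζ 1 k) := by
  simp only [det3_eq, verticalPath_zero_apply, verticalPath_one_apply, verticalPath_two_apply]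
  ring

lemma isPositiveShift_verticalPath (hp : IsGenericTriangulation G p)
    (hz : ∀ i j k, IsNonPolarFace G p i j k →
      0 ≤ det3 (verticalPath p ζ 1 i) (verticalPath p ζ 1 j) (verticalPath p ζ 1 k))
    {t : ℝ} (h0 : 0 ≤ t) (h1 : t < 1) : IsPositiveShift G p (verticalPath p ζ t) := by
  refine ⟨verticalPath_zero_apply t, verticalPath_one_apply t, fun i j k hf => ?_⟩
  rw [det3_verticalPath]
  have := mul_pos (sub_pos.2 h1) (hf.det3_pos hp)
  have := mul_nonneg h0 (hz i j k hf)
  linarith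

/-- A solution that is negative at the north face is negative everywhere. -/
lemma neg_of_neg_northFace (hn : 4 ≤ n) (hp : IsGenericTriangulation G p)
    (hpoles : ∀ i j k, ¬ (IsNorthFace G p i j k ∧ IsSouthFace G p i j k))
    (hz : ∀ i j k, IsNonPolarFace G p i j k →
      0 ≤ det3 (verticalPath p ζ 1 i) (verticalPath p ζ 1 j) (verticalPath p ζ 1 k))
    (hN : ∀ i j k, IsNorthFace G p i j k → ζ i < 0) (m : Fin n) : ζ m < 0 := by
  obtain ⟨i, j, k, hf⟩ := hp.exists_northFace hn
  have side : ∃ (i j k : Fin n) (h a b : ℝ), IsNorthFace G p i j k ∧ 0 ≤ a ∧ 0 ≤ b ∧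
      (p m : E3) + h • zAxis = a • (p i : E3) + b • (p j : E3) := by
    obtain ⟨h, a, b, ha, hb, e | e | e⟩ :=
      (hf.winds hp hpoles).exists_side (hf.1.det3_ne_zero hp) (p m : E3)
    · exact ⟨i, j, k, h, a, b, hf, ha, hb, e⟩
    · exact ⟨j, k, i, h, a, b, hf.rotate, ha, hb, e⟩
    · exact ⟨k, i, j, h, a, b, hf.rotate.rotate, ha, hb, e⟩
  obtain ⟨i, j, k, h, a, b, hf, ha, hb, e⟩ := side
  have mem_m : (p m : E3) ∈ coneDrawing G (fun i => (p i : E3)) :=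
    mem_drawing.1 (Or.inl ⟨m, rfl⟩)
  -- The vertex lies on or below the side, since above it is the interior of the north face.
  have hh : 0 ≤ h := by
    by_contra hneg
    refine hf.1.notMem_coneDrawing (w := (p m : E3)) ?_ mem_m
    have := ((hf.winds hp hpoles).side_add_mem_iff (hf.1.det3_ne_zero hp) (h := -h) ha hb).2
      (by linarith)
    rw [← e] at this
    convert this using 1
    module
  have c0 := congrArg (fun v : E3 => v 0) e
  have c1 := congrArg (fun v : E3 => v 1) e
  have c2 := congrArg (fun v : E3 => v 2) e
  simp only [PiLp.add_apply, PiLp.smul_apply, smul_eq_mul, zAxis_zero, zAxis_one, zAxis_two,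
    mul_zero, mul_one, add_zero] at c0 c1 c2
  have le : ∀ t : ℝ, t ∈ Set.Ico (0 : ℝ) 1 → verticalPath p ζ t m 2 ≤
      a * verticalPath p ζ t i 2 + b * verticalPath p ζ t j 2 := by
    intro t ht
    have hQ := isPositiveShift_verticalPath hp hz ht.1 ht.2
    have l1 := lifts_vertex (G := G) (p := p) (Q := verticalPath p ζ t) m zero_le_one
    have l2 := lifts_edge (p := p) (Q := verticalPath p ζ t) hf.1.1 ha hb
    have := mt (hQ.lt_iff hn hp hpoles l2 l1 (by simpa using c0.symm) (by simpa using c1.symm)).1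
      (by simp; linarith)
    simpa using this
  -- At time `1` the determinants may vanish, so the inequality is obtained as a limit.
  have le1 : verticalPath p ζ 1 m 2 ≤
      a * verticalPath p ζ 1 i 2 + b * verticalPath p ζ 1 j 2 := by
    have hcl : IsClosed {t : ℝ | verticalPath p ζ t m 2 ≤
        a * verticalPath p ζ t i 2 + b * verticalPath p ζ t j 2} := by
      simp only [verticalPath_two_apply]
      exact isClosed_le (by fun_prop) (by fun_prop)
    have := closure_minimal le hcl
    rw [closure_Ico (zero_ne_one)] at this
    exact this ⟨zero_le_one, le_rfl⟩
  simp only [verticalPath_two_apply, one_mul, add_sub_cancel] at le1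
  have ni := hN i j k hf
  have nj := hN j k i hf.rotate
  -- The coefficients are not both zero, because the vertex is off the axis.
  rcases ha.eq_or_lt with rfl | ha
  · rcases hb.eq_or_lt with rfl | hb
    · rcases hp.horizontal_ne_zero hn m with h | h
      · exact absurd (by simpa using c0) h
      · exact absurd (by simpa using c1) h
    · have := mul_neg_of_pos_of_neg hb nj
      linarith
  · have := mul_neg_of_pos_of_neg ha ni
    have := mul_nonpos_of_nonneg_of_nonpos hb nj.le
    linarith

/-- Used for genericity just before time `1`: an affine function that is nonzero at `0` has at most
one zero. -/
lemma eventually_affine_ne_zero {a b : ℝ} (ha : a ≠ 0) :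
    ∀ᶠ t in nhdsWithin (1 : ℝ) (Set.Iio 1), (1 - t) * a + t * b ≠ 0 := by
  by_cases hb : b = 0
  · filter_upwards [self_mem_nhdsWithin] with t ht
    have ht : t < 1 := ht
    rw [hb, mul_zero, add_zero]
    exact mul_ne_zero (sub_pos.2 ht).ne' ha
  · have hc : Continuous fun t : ℝ => (1 - t) * a + t * b := by fun_prop
    refine nhdsWithin_le_nhds (hc.continuousAt.eventually_ne ?_)
    simpa using hb

lemma sinkable_of_feasible (hn : 4 ≤ n) (hp : IsGenericTriangulation G p)
    (hpoles : ∀ i j k, ¬ (IsNorthFace G p i j k ∧ IsSouthFace G p i j k)) {X : Fin n → E3}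
    (hX : IsHomogeneousCoordinates p X) (hL : (sinkLP G p X).Feasible) : Sinkable G p := by
  obtain ⟨z, hzN, hz⟩ := sinkLP_feasible_iff.1 hL
  choose r hr hXr using hX
  -- The feasible heights belong to `X`; dividing by `r` transfers them to the unit vectors `p`.
  set ζ : Fin n → ℝ := fun i => z i / r i with hζ
  have hz : ∀ i j k, IsNonPolarFace G p i j k →
      0 ≤ det3 (verticalPath p ζ 1 i) (verticalPath p ζ 1 j) (verticalPath p ζ 1 k) := by
    intro i j k hf
    have := hz i j k hf
    rw [vol'_eq_mul_det3 (Q := verticalPath p ζ 1) (r := r)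
      (fun i => by simp [hXr, verticalPath_zero_apply])
      (fun i => by simp [hXr, verticalPath_one_apply])
      (fun i => by
        have := (hr i).ne'
        rw [verticalPath_two_apply, hζ]; field_simp; ring)] at this
    have hrr : 0 < r i * r j * r k := mul_pos (mul_pos (hr i) (hr j)) (hr k)
    exact (mul_nonneg_iff_of_pos_left hrr).1 this
  have hneg : ∀ m, ζ m < 0 := neg_of_neg_northFace hn hp hpoles hz fun i j k hN => by
    simp only [hζ, hzN i j k hN]
    exact div_neg_of_neg_of_pos (by norm_num) (hr i)
  have ev1 : ∀ᶠ t in nhdsWithin (1 : ℝ) (Set.Iio 1), ∀ i, verticalPath p ζ t i 2 < 0 := by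
    rw [Filter.eventually_all]
    intro i
    have hc : Continuous fun t : ℝ => verticalPath p ζ t i 2 := by
      simp only [verticalPath_two_apply]; fun_prop
    refine nhdsWithin_le_nhds (hc.continuousAt.eventually_lt_const ?_)
    simpa [verticalPath_two_apply] using hneg i
  have ev2 : ∀ᶠ t in nhdsWithin (1 : ℝ) (Set.Iio 1), ∀ i j k, i ≠ j → j ≠ k → k ≠ i →
      det3 (verticalPath p ζ t i) (verticalPath p ζ t j) (verticalPath p ζ t k) ≠ 0 := by
    simp only [Filter.eventually_all]
    intro i j k hij hjk hki
    filter_upwards [eventually_affine_ne_zero (hp.det3_ne_zero hij hjk hki)] with t ht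
    rw [det3_verticalPath]
    exact ht
  have ev3 : ∀ᶠ t in nhdsWithin (1 : ℝ) (Set.Iio 1), 0 < t :=
    nhdsWithin_le_nhds (lt_mem_nhds zero_lt_one)
  -- A time before `1` at which all vertices are southern and no three are coplanar with the origin;
  -- the morph runs only up to `T`.
  obtain ⟨T, ⟨⟨hT1, hT2⟩, hT0⟩, hT⟩ := (((ev1.and ev2).and ev3).and self_mem_nhdsWithin).exists
  have hT : T < 1 := hT
  have shift : ∀ t : ℝ, 0 ≤ t → t ≤ 1 → IsPositiveShift G p (verticalPath p ζ (t * T)) :=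
    fun t h0 h1 => isPositiveShift_verticalPath hp hz (by positivity) (by nlinarith)
  have shiftT : IsPositiveShift G p (verticalPath p ζ T) := by
    simpa using shift 1 zero_le_one le_rfl
  refine ⟨fun i => toSphere (verticalPath p ζ T i),
    shiftT.isGenericTriangulation hn hp hpoles hT2, fun i => ?_,
    fun t i => toSphere (verticalPath p ζ (t * T) i), ?_, ?_, ?_, ?_, ?_⟩
  · have h0 := shiftT.ne_zero hn hp i
    rw [coe_toSphere h0]
    simpa using mul_neg_of_pos_of_neg (inv_pos.2 (norm_pos_iff.2 h0)) (hT1 i)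
  · intro i
    refine continuousOn_toSphere.comp_continuous ?_ fun t =>
      (shift t t.2.1 t.2.2).ne_zero hn hp i
    simp only [verticalPath]
    fun_prop
  · funext i
    simp [verticalPath, toSphere_coe]
  · funext i
    simp
  · intro t
    exact (shift t t.2.1 t.2.2).embedding hn hp hpoles
  · intro t i
    have hQ := shift t t.2.1 t.2.2
    have h0 := hQ.ne_zero hn hp i
    have hpos : 0 < ‖verticalPath p ζ (t * T) i‖⁻¹ := inv_pos.2 (norm_pos_iff.2 h0)
    obtain ⟨s, θ, hs, e0, e1⟩ := exists_polar _ _ (hp.horizontal_ne_zero hn i)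
    refine ⟨θ, ⟨s, hs, e0, e1⟩, ‖verticalPath p ζ (t * T) i‖⁻¹ * s, mul_pos hpos hs, ?_, ?_⟩
    · rw [coe_toSphere h0, PiLp.smul_apply, hQ.zero, e0, smul_eq_mul, mul_assoc]
    · rw [coe_toSphere h0, PiLp.smul_apply, hQ.one, e1, smul_eq_mul, mul_assoc]

end Triangulation

end Sinking

end

theorem lemmaL {n : ℕ} (hn : 4 ≤ n) (G : SimpleGraph (Fin n))
    (p : Fin n → Sinking.S2) (hp : Sinking.IsGenericTriangulation G p)
    (hpoles : ∀ i j k, ¬ (Sinking.IsNorthFace G p i j k ∧ Sinking.IsSouthFace G p i j k))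
    (X : Fin n → Sinking.E3) (hX : Sinking.IsHomogeneousCoordinates p X) :
    Sinking.Sinkable G p ↔ (Sinking.sinkLP G p X).Feasible :=
  ⟨fun h => h.feasible hn hp hpoles hX, fun h => Sinking.sinkable_of_feasible hn hp hpoles hX h⟩
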